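/- \textbf{Model.} Fix $\lambda_R,\mu_v\ge 0$, $\lambda_b>0$, $P_v>0$, $\sigma^2\ge 0$, $z>0$, $\alpha>1$ and an outer radius $R\in[0,\infty]$; if $R=\infty$, assume $\alpha>2$. A line in $\mathbb{R}^2$ is represented by $(\theta,y)$, the angle and the signed length of the perpendicular dropped onto it from the origin. The typical receiver is at the origin. The roads are the typical road, a fixed line through the origin, together with the lines of a Poisson line process whose representation is a Poisson point process of intensity $\lambda_R$ (with respect to Lebesgue measure) on $[0,\pi]\times[-R,R]$. Every road carries a homogeneous one-dimensional Poisson process of intensity $\mu_v$ of interfering vehicles. The base stations form a planar homogeneous Poisson process of intensity $\lambda_b$, and $R_b$ is the distance from the transmitting vehicle to its nearest base station. The channel gain $h$ of the link and the channel gains $h_x$ of the interfering vehicles $x$ are exponentially distributed with mean $1$. The line process, the vehicle processes on the individual roads, the base stations and all the gains are mutually independent. For $r>0$ let $$I_r=\sum_x P_vh_x|x|^{-\alpha},\qquad I_v=\sum_x P_vh_x|x|^{-\alpha},$$ where $x$ runs over the vehicles outside the disc $\mathcal B(0,r)$ that lie on the typical road (for $I_r$), respectively on all other roads (for $I_v$).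 Let $\mathcal L_{I}(s|r)=\mathbb E[e^{-sI}]$ for $I\in\{I_v,I_r\}$, and $$\mathrm{SINR}(r)=\frac{P_v r^{-\alpha}h}{I_v+I_r+\sigma^2}.$$ \textbf{Theorem (uplink success probability for the V2B link).} (1) For every $r_b>0$ with $r_b\le R$, with $s=\dfrac{z}{P_vr_b^{-\alpha}}$, $$P^S_{v2b}(z|r_b):=\Pr[\mathrm{SINR}(r_b)>z]=\exp\Big(-\frac{z\sigma^2}{P_vr_b^{-\alpha}}\Big)\,\mathcal L_{I_v}(s|r_b)\,\mathcal L_{I_r}(s|r_b),$$ where, at this value of $s$ and with $r=r_b$, $$\mathcal L_{I_r}(s|r)=\exp\Big[-\frac{2rz\mu_v\;{}_2F_1\big(1,\tfrac{\alpha-1}{\alpha};2-\tfrac1\alpha;-z\big)}{\alpha-1}\Big],$$ $$\mathcal L_{I_v}(s|r)=\exp\Big(-2\pi\lambda_R\int_0^r\big(1-\mathcal L_{in}(y)\big)dy\Big)\exp\Big(-2\pi\lambda_R\int_r^R\big(1-\mathcal L_{out}(y)\big)dy\Big),$$ $$\mathcal L_{in}(y)=\exp\Big[-2\mu_v\int_{\sqrt{r^2-y^2}}^\infty\Big(1-\frac{1}{1+sP_v(y^2+t^2)^{-\alpha/2}}\Big)dt\Big],$$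 $$\mathcal L_{out}(y)=\exp\Big[-2\mu_v\int_{0}^\infty\Big(1-\frac{1}{1+sP_v(y^2+t^2)^{-\alpha/2}}\Big)dt\Big].$$ Here ${}_2F_1$ is the Gauss hypergeometric function, continued analytically to $(-\infty,1)$. (2) The same expression is the conditional success probability given the distance to the nearest base station: almost surely on $\{R_b\le R\}$, the conditional probability of $\{\mathrm{SINR}(R_b)>z\}$ given $R_b$ equals the right-hand side of (1), with these formulas for $\mathcal L_{I_v}$ and $\mathcal L_{I_r}$, at $r_b=R_b$. -/

import Mathlib

open MeasureTheory ProbabilityTheory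
open scoped ENNReal NNReal

namespace V2X

noncomputable section

/-- The Euclidean plane. -/
abbrev Plane : Type := EuclideanSpace ℝ (Fin 2)

/-- An enumerated finite or countable configuration of points of `E`: the pair `(n, x)` stands for
the points `x i` with `i < n` (all of them if `n = ⊤`); the other values of `x` are ignored. -/
abbrev PointConfig (E : Type*) : Type _ := ℕ∞ × (ℕ → E)

/-- The number of points of a configuration that lie in `B`, with multiplicity. -/
def PointConfig.count {E : Type*} (c : PointConfig E) (B : Set E) : ℕ∞ :=
  {i : ℕ | (i : ℕ∞) < c.1 ∧ c.2 i ∈ B}.encard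

/-- The set of the points of a configuration. -/
def PointConfig.points {E : Type*} (c : PointConfig E) : Set E :=
  {x | ∃ i : ℕ, (i : ℕ∞) < c.1 ∧ c.2 i = x}

/-- `X` is a Poisson point process on `E` with intensity measure `Λ`: the number of points in a
set `B` of finite intensity is Poisson distributed with mean `Λ B`, and the numbers of points in
pairwise disjoint sets are independent. -/
structure IsPoissonProcess {Ω E : Type*} [MeasurableSpace Ω] [MeasurableSpace E]
    (P : Measure Ω) (X : Ω → PointConfig E) (Λ : Measure E) : Prop where
  measurable : Measurable X
  count_law : ∀ B : Set E, MeasurableSet B → Λ B ≠ ∞ →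
    HasLaw (fun ω => (X ω).count B)
      ((poissonMeasure (Λ B).toNNReal).map (fun k : ℕ => (k : ℕ∞))) P
  count_indep : ∀ (n : ℕ) (B : Fin n → Set E), (∀ i, MeasurableSet (B i)) →
    Pairwise (fun i j => Disjoint (B i) (B j)) →
    iIndepFun (fun i ω => (X ω).count (B i)) P

/-- Lines are represented by the angle `θ` and the signed length `y` of the perpendicular dropped
onto them from the origin. For a line process restricted to the lines that meet the disc of radius
`R` (all lines if `R = ∞`), the intensity on the representation space `[0, π] × [-R, R]` is
`lamR` times Lebesgue measure. -/
def lineIntensity (lamR : ℝ≥0) (R : ℝ≥0∞) : Measure (ℝ × ℝ) :=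
  (lamR : ℝ≥0∞) • (volume : Measure (ℝ × ℝ)).restrict
    (Set.Icc 0 Real.pi ×ˢ {y : ℝ | ENNReal.ofReal |y| ≤ R})

/-- The point at signed displacement `t` from the foot of the perpendicular, on the line with
representation `l = (θ, y)`. -/
def linePoint (l : ℝ × ℝ) (t : ℝ) : Plane :=
  !₂[l.2 * Real.cos l.1 - t * Real.sin l.1, l.2 * Real.sin l.1 + t * Real.cos l.1]

/-- Labels of the independent sources of randomness. A road label `none` is the typical road
(through the origin), `some i` is the `i`-th road of the Poisson line process. -/
inductive Source : Type
  | stations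
  | roads
  | vehicles (road : Option ℕ)
  | fading (road : Option ℕ) (j : ℕ)
  | link

/-- The cellular V2X network on a probability space `(Ω, P)`.
Roads and vehicles are described in coordinates whose origin is the typical receiver; base stations
only enter through their distances to the transmitting vehicle, which is located at
`transmitter`. -/
structure Network {Ω : Type*} [MeasurableSpace Ω] (P : Measure Ω)
    (lamR muV lamB : ℝ≥0) (R : ℝ≥0∞) where
  /-- the base stations -/
  stations : Ω → PointConfig Plane
  /-- the location of the transmitting vehicle -/
  transmitter : Plane
  /-- the roads other than the typical one, in the representation `(θ, y)` -/
  roads : Ω → PointConfig (ℝ × ℝ)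
  /-- the angle of the typical road, which passes through the origin -/
  angle : ℝ
  /-- the vehicles on each road, as signed displacements along it -/
  vehicles : Option ℕ → Ω → PointConfig ℝ
  /-- the channel gain from the `j`-th vehicle of a road to the receiver -/
  fading : Option ℕ → ℕ → Ω → ℝ
  /-- the channel gain of the link from the transmitting vehicle to the receiver -/
  link : Ω → ℝ
  stations_poisson : IsPoissonProcess P stations ((lamB : ℝ≥0∞) • volume)
  roads_poisson : IsPoissonProcess P roads (lineIntensity lamR R)
  vehicles_poisson : ∀ k, IsPoissonProcess P (vehicles k) ((muV : ℝ≥0∞) • volume)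
  fading_measurable : ∀ k j, Measurable (fading k j)
  fading_law : ∀ k j, HasLaw (fading k j) (expMeasure 1) P
  link_measurable : Measurable link
  link_law : HasLaw link (expMeasure 1) P
  /-- all sources of randomness are mutually independent -/
  indep : iIndep
    (fun s : Source => match s with
      | Source.stations => MeasurableSpace.comap stations inferInstance
      | Source.roads => MeasurableSpace.comap roads inferInstance
      | Source.vehicles k => MeasurableSpace.comap (vehicles k) inferInstance
      | Source.fading k j => MeasurableSpace.comap (fading k j) inferInstance
      | Source.link => MeasurableSpace.comap link inferInstance) P

namespace Network

variable {Ω : Type*} [MeasurableSpace Ω] {P : Measure Ω} {lamR muV lamB : ℝ≥0} {R : ℝ≥0∞}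

/-- The distance `R_b` from the transmitting vehicle to its nearest base station. -/
def nearestStationDist (N : Network P lamR muV lamB R) (ω : Ω) : ℝ :=
  Metric.infDist N.transmitter (N.stations ω).points

/-- The interference received at the origin from the vehicles with label `k` on the line `l` that
lie outside the disc of radius `r`: the sum of `Pv * h * D ^ (-α)`. -/
def lineInterference (N : Network P lamR muV lamB R) (Pv α r : ℝ) (k : Option ℕ) (l : ℝ × ℝ)
    (ω : Ω) : ℝ≥0∞ :=
  open Classical in
  ∑' j : ℕ, if (j : ℕ∞) < (N.vehicles k ω).1 ∧ r < ‖linePoint l ((N.vehicles k ω).2 j)‖ then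
    ENNReal.ofReal (Pv * N.fading k j ω * ‖linePoint l ((N.vehicles k ω).2 j)‖ ^ (-α)) else 0

/-- `I_r`: the interference from the road through the origin. -/
def typicalRoadInterference (N : Network P lamR muV lamB R) (Pv α r : ℝ) (ω : Ω) : ℝ≥0∞ :=
  N.lineInterference Pv α r none (N.angle, 0) ω

/-- `I_v`: the interference from all other roads. -/
def otherRoadsInterference (N : Network P lamR muV lamB R) (Pv α r : ℝ) (ω : Ω) : ℝ≥0∞ :=
  open Classical in
  ∑' i : ℕ, if (i : ℕ∞) < (N.roads ω).1 then
    N.lineInterference Pv α r (some i) ((N.roads ω).2 i) ω else 0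

/-- The SINR `Pv r^(-α) h / (I_v + I_r + σ²)` at link distance (and exclusion radius) `r`. -/
def sinr (N : Network P lamR muV lamB R) (Pv α σ2 r : ℝ) (ω : Ω) : ℝ≥0∞ :=
  ENNReal.ofReal (Pv * r ^ (-α) * N.link ω) /
    (N.otherRoadsInterference Pv α r ω + N.typicalRoadInterference Pv α r ω + ENNReal.ofReal σ2)

end Network

/-- `exp (-x)` for `x ∈ [0, ∞]`, with `exp (-∞) = 0`. -/
def expNeg (x : ℝ≥0∞) : ℝ := if x = ∞ then 0 else Real.exp (-x.toReal)

/-- The Laplace transform `E[exp (-s I)]` of a random variable with values in `[0, ∞]`. -/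
def laplaceTransform {Ω : Type*} [MeasurableSpace Ω] (P : Measure Ω) (I : Ω → ℝ≥0∞) (s : ℝ) : ℝ :=
  ∫ ω, expNeg (ENNReal.ofReal s * I ω) ∂P

/-- The Gauss hypergeometric function `₂F₁(a, b; c; x)` for real `c > b > 0` and `x < 1`, by Euler's
integral. (The power series only converges for `|x| < 1`, while the argument `x = -z` is needed for
every `z > 0`.) -/
def gaussHypergeometric (a b c x : ℝ) : ℝ :=
  Real.Gamma c / (Real.Gamma b * Real.Gamma (c - b)) *
    ∫ u in (0 : ℝ)..1, u ^ (b - 1) * (1 - u) ^ (c - b - 1) * (1 - x * u) ^ (-a)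

/-- Formula for the Laplace transform of the interference from a single road at distance `y > r`
from the origin. -/
def laplaceRoadOut (muV Pv α s y : ℝ) : ℝ :=
  Real.exp (-2 * muV *
    ∫ t in Set.Ioi (0 : ℝ), (1 - 1 / (1 + s * Pv * (y ^ 2 + t ^ 2) ^ (-α / 2))))

/-- Formula for the Laplace transform of the interference from a single road at distance `y < r`
from the origin. -/
def laplaceRoadIn (muV Pv α s r y : ℝ) : ℝ :=
  Real.exp (-2 * muV *
    ∫ t in Set.Ioi (√(r ^ 2 - y ^ 2)), (1 - 1 / (1 + s * Pv * (y ^ 2 + t ^ 2) ^ (-α / 2))))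

/-- The formula for the Laplace transform of `I_v` at `s`, with exclusion radius `r`. -/
def laplaceOtherRoads (lamR muV : ℝ) (R : ℝ≥0∞) (Pv α s r : ℝ) : ℝ :=
  Real.exp (-2 * Real.pi * lamR *
      ∫ y in Set.Ioc 0 r, (1 - laplaceRoadIn muV Pv α s r y)) *
    Real.exp (-2 * Real.pi * lamR *
      ∫ y in {y : ℝ | r < y ∧ ENNReal.ofReal y ≤ R}, (1 - laplaceRoadOut muV Pv α s y))

/-- The formula for the Laplace transform of `I_r` at `s = z r^α / Pv`, with exclusion radius
`r`. -/
def laplaceTypicalRoad (muV α z r : ℝ) : ℝ :=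
  Real.exp (-(2 * r * z * muV *
    gaussHypergeometric 1 ((α - 1) / α) (2 - 1 / α) (-z) / (α - 1)))

/-- The closed form of the uplink success probability at link distance `r`. -/
def successFormula (lamR muV : ℝ) (R : ℝ≥0∞) (Pv α σ2 z r : ℝ) : ℝ :=
  Real.exp (-(z * σ2 / (Pv * r ^ (-α)))) *
    laplaceOtherRoads lamR muV R Pv α (z / (Pv * r ^ (-α))) r *
    laplaceTypicalRoad muV α z r

end

end V2X

open Filter Topology

namespace V2X

/-! ### The function `expNeg` -/

/-! The event that the SINR exceeds `z` is `s * (I_v + I_r + σ²) < h` with `h` a unit exponential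
gain independent of the rest (`lt_sinr_iff`). Since `h` has tail `exp (-x)`, the success probability
is `E[exp (-s (I_v + I_r + σ²))]` (`measureReal_lt_ofReal_link`), and independence of the typical
road from the others splits this into three factors (`measureReal_lt_sinr`).

The two Laplace transforms are computed by averaging from the inside out. A gain at distance `x`
contributes `1 / (1 + s Pv x^(-α))`, so averaging over the gains of a road leaves `expNeg` of a sum
over its vehicles. The Laplace functional of a Poisson process
(`IsPoissonProcess.integral_expNeg_sum`) turns this into `expNeg (roadExponent ..)`, which depends
only on the line. For `I_v` the sum of these exponents over the roads is again a sum over a Poisson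
process, and the same functional applies. Each average of an `expNeg` is again an `expNeg`, and all
exponents live in `[0, ∞]`, so no almost sure finiteness of the interference is ever needed.

What remains is calculus. A road exponent depends only on `|y|`, the angle integrates to `π`, and
evenness in `y` and `t` gives the factors `2`. The assumption `α > 2` for `R = ∞` makes the exponent
of `I_v` a convergent integral. The typical road is the case `y = 0`, where a power substitution
produces Euler's integral.

For the conditional statement, the base stations are independent of all other sources, so
conditioning on `R_b` amounts to substituting it for `r` (`condExp_indicator_of_indepFun`). This is
legitimate because `R_b > 0` almost surely (`ae_nearestStationDist_pos`). -/

lemma expNeg_eq_toReal_exp (x : ℝ≥0∞) : expNeg x = (EReal.exp (-(x : EReal))).toReal := by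
  unfold expNeg
  split_ifs with h
  · simp [h]
  · lift x to ℝ≥0 using h
    have : -((x : ℝ≥0∞) : EReal) = ((-(x : ℝ) : ℝ) : EReal) := rfl
    rw [this, EReal.exp_coe, ENNReal.toReal_ofReal (Real.exp_pos _).le, ENNReal.coe_toReal]

@[simp] lemma expNeg_zero : expNeg 0 = 1 := by simp [expNeg]

@[simp] lemma expNeg_top : expNeg ∞ = 0 := by simp [expNeg]

lemma expNeg_ofReal {x : ℝ} (hx : 0 ≤ x) : expNeg (ENNReal.ofReal x) = Real.exp (-x) := by
  simp [expNeg, ENNReal.toReal_ofReal hx]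

lemma expNeg_of_ne_top {x : ℝ≥0∞} (hx : x ≠ ∞) : expNeg x = Real.exp (-x.toReal) := by
  simp [expNeg, hx]

lemma expNeg_nonneg (x : ℝ≥0∞) : 0 ≤ expNeg x := by
  unfold expNeg
  split_ifs <;> positivity

lemma expNeg_le_one (x : ℝ≥0∞) : expNeg x ≤ 1 := by
  unfold expNeg
  split_ifs <;> simp

/-- Continuity at `∞` is included: it allows limits of partial sums and of simple functions even
when they diverge. -/
lemma continuous_expNeg : Continuous expNeg := by
  have h : expNeg = fun x : ℝ≥0∞ => (EReal.exp (-(x : EReal))).toReal :=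
    funext expNeg_eq_toReal_exp
  rw [h, continuous_iff_continuousAt]
  intro x
  refine (ENNReal.continuousAt_toReal ?_).comp
    (ENNReal.continuous_exp.comp (continuous_neg.comp continuous_coe_ennreal_ereal)).continuousAt
  refine ((EReal.exp_le_one_iff.2 ?_).trans_lt ENNReal.one_lt_top).ne
  rw [EReal.neg_le, neg_zero]
  exact EReal.coe_ennreal_nonneg x

@[fun_prop] lemma measurable_expNeg : Measurable expNeg := continuous_expNeg.measurable

lemma expNeg_add (x y : ℝ≥0∞) : expNeg (x + y) = expNeg x * expNeg y := by
  by_cases hx : x = ∞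
  · simp [hx]
  by_cases hy : y = ∞
  · simp [hy]
  rw [expNeg_of_ne_top hx, expNeg_of_ne_top hy, expNeg_of_ne_top (by simp [hx, hy]),
    ENNReal.toReal_add hx hy, ← Real.exp_add]
  ring_nf

lemma expNeg_sum {ι : Type*} (s : Finset ι) (a : ι → ℝ≥0∞) :
    expNeg (∑ i ∈ s, a i) = ∏ i ∈ s, expNeg (a i) := by
  classical
  induction s using Finset.induction_on with
  | empty => simp
  | insert i s hi ih => rw [Finset.sum_insert hi, Finset.prod_insert hi, expNeg_add, ih]

lemma antitone_expNeg : Antitone expNeg := fun x y h => by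
  obtain ⟨c, rfl⟩ := exists_add_of_le h
  rw [expNeg_add]
  exact mul_le_of_le_one_right (expNeg_nonneg _) (expNeg_le_one _)

/-! ### Laplace transforms and independence -/

section Independence

variable {Ω : Type*} [MeasurableSpace Ω] {P : Measure Ω}

lemma integral_expNeg_add {Y Z : Ω → ℝ≥0∞} (hY : Measurable Y) (hZ : Measurable Z)
    (hYZ : IndepFun Y Z P) :
    ∫ ω, expNeg (Y ω + Z ω) ∂P = (∫ ω, expNeg (Y ω) ∂P) * ∫ ω, expNeg (Z ω) ∂P := by
  simp_rw [expNeg_add]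
  exact (hYZ.comp measurable_expNeg measurable_expNeg).integral_fun_mul_eq_mul_integral
    (measurable_expNeg.comp hY).aestronglyMeasurable
    (measurable_expNeg.comp hZ).aestronglyMeasurable

variable [IsProbabilityMeasure P]

lemma norm_expNeg_le_one (x : ℝ≥0∞) : ‖expNeg x‖ ≤ 1 := by
  rw [Real.norm_of_nonneg (expNeg_nonneg x)]
  exact expNeg_le_one x

lemma integrable_expNeg {Y : Ω → ℝ≥0∞} (hY : Measurable Y) :
    Integrable (fun ω => expNeg (Y ω)) P :=
  Integrable.of_bound (measurable_expNeg.comp hY).aestronglyMeasurable 1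
    (ae_of_all _ fun _ => norm_expNeg_le_one _)

lemma tendsto_integral_expNeg {Y : ℕ → Ω → ℝ≥0∞} {Z : Ω → ℝ≥0∞} (hY : ∀ n, Measurable (Y n))
    (h : ∀ ω, Tendsto (fun n => Y n ω) atTop (𝓝 (Z ω))) :
    Tendsto (fun n => ∫ ω, expNeg (Y n ω) ∂P) atTop (𝓝 (∫ ω, expNeg (Z ω) ∂P)) :=
  tendsto_integral_of_dominated_convergence (fun _ => 1)
    (fun n => (measurable_expNeg.comp (hY n)).aestronglyMeasurable) (integrable_const 1)
    (fun _ => ae_of_all _ fun _ => norm_expNeg_le_one _)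
    (ae_of_all _ fun ω => (continuous_expNeg.tendsto _).comp (h ω))

/-- Integration of a bounded function of two independent variables, one variable at a time. -/
lemma integral_comp_of_indepFun {E F : Type*} [MeasurableSpace E] [MeasurableSpace F]
    {X : Ω → E} {Y : Ω → F} (hX : Measurable X) (hY : Measurable Y) (hXY : IndepFun X Y P)
    {f : E → F → ℝ} (hf : Measurable (Function.uncurry f)) {C : ℝ} (hC : ∀ x y, ‖f x y‖ ≤ C) :
    ∫ ω, f (X ω) (Y ω) ∂P = ∫ ω, ∫ ω', f (X ω) (Y ω') ∂P ∂P := by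
  have hmap := (indepFun_iff_map_prod_eq_prod_map_map hX.aemeasurable hY.aemeasurable).1 hXY
  have := Measure.isProbabilityMeasure_map (μ := P) hX.aemeasurable
  have := Measure.isProbabilityMeasure_map (μ := P) hY.aemeasurable
  have hsm := hf.stronglyMeasurable
  calc ∫ ω, f (X ω) (Y ω) ∂P = ∫ p, Function.uncurry f p ∂(P.map fun ω => (X ω, Y ω)) := by
        rw [integral_map (hX.prodMk hY).aemeasurable hsm.aestronglyMeasurable]
        rfl
    _ = ∫ x, ∫ y, f x y ∂(P.map Y) ∂(P.map X) := by
        rw [hmap, integral_prod _ (Integrable.of_bound hsm.aestronglyMeasurable C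
          (ae_of_all _ fun p => hC p.1 p.2))]
        rfl
    _ = ∫ ω, ∫ y, f (X ω) y ∂(P.map Y) ∂P := by
        rw [integral_map hX.aemeasurable]
        exact hsm.integral_prod_right.aestronglyMeasurable
    _ = ∫ ω, ∫ ω', f (X ω) (Y ω') ∂P ∂P := by
        congr 1
        ext ω
        rw [integral_map hY.aemeasurable]
        exact (hf.comp measurable_prodMk_left).aestronglyMeasurable

/-- The inductive step of the averaging scheme: integrating out the inner source `Y` for each frozen
`x` leaves an exponent in the outer source alone. -/
lemma integral_expNeg_of_indepFun {E F : Type*} [MeasurableSpace E] [MeasurableSpace F]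
    {X : Ω → E} {Y : Ω → F} (hX : Measurable X) (hY : Measurable Y) (hXY : IndepFun X Y P)
    {G : E → F → ℝ≥0∞} (hG : Measurable (Function.uncurry G)) {H : E → ℝ≥0∞}
    (h : ∀ x, ∫ ω, expNeg (G x (Y ω)) ∂P = expNeg (H x)) :
    ∫ ω, expNeg (G (X ω) (Y ω)) ∂P = ∫ ω, expNeg (H (X ω)) ∂P := by
  rw [integral_comp_of_indepFun (f := fun x y => expNeg (G x y)) hX hY hXY
    (measurable_expNeg.comp hG) (fun _ _ => norm_expNeg_le_one _)]
  simp_rw [h]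

/-- The Laplace transform of a series of successively independent random variables. -/
lemma integral_expNeg_tsum {Y : ℕ → Ω → ℝ≥0∞} (hY : ∀ n, Measurable (Y n))
    (hind : ∀ n, IndepFun (fun ω => ∑ i ∈ Finset.range n, Y i ω) (Y n) P) {a : ℕ → ℝ≥0∞}
    (h : ∀ n, ∫ ω, expNeg (Y n ω) ∂P = expNeg (a n)) :
    ∫ ω, expNeg (∑' n, Y n ω) ∂P = expNeg (∑' n, a n) := by
  have hm : ∀ n, Measurable fun ω => ∑ i ∈ Finset.range n, Y i ω := fun n =>
    Finset.measurable_fun_sum _ fun i _ => hY i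
  have hfin : ∀ n, ∫ ω, expNeg (∑ i ∈ Finset.range n, Y i ω) ∂P
      = expNeg (∑ i ∈ Finset.range n, a i) := by
    intro n
    induction n with
    | zero => simp
    | succ n ih =>
      simp_rw [Finset.sum_range_succ]
      rw [integral_expNeg_add (hm n) (hY n) (hind n), ih, h, expNeg_add]
  refine tendsto_nhds_unique (tendsto_integral_expNeg hm fun ω => ENNReal.tendsto_nat_tsum _) ?_
  simp_rw [hfin]
  exact (continuous_expNeg.tendsto _).comp (ENNReal.tendsto_nat_tsum a)

end Independence

end V2X

namespace V2X

/-! ### The Laplace functional of a Poisson process -/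

namespace PointConfig

variable {E : Type*}

/-- The sum of `f` over the points of a configuration. -/
noncomputable def sum (c : PointConfig E) (f : E → ℝ≥0∞) : ℝ≥0∞ :=
  open Classical in ∑' i : ℕ, if (i : ℕ∞) < c.1 then f (c.2 i) else 0

/-- The counting measure of a configuration. -/
noncomputable def toMeasure [MeasurableSpace E] (c : PointConfig E) : Measure E :=
  open Classical in
  Measure.sum fun i : ℕ => if (i : ℕ∞) < c.1 then Measure.dirac (c.2 i) else 0

variable [MeasurableSpace E]

lemma lintegral_toMeasure (c : PointConfig E) {f : E → ℝ≥0∞} (hf : Measurable f) :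
    ∫⁻ x, f x ∂c.toMeasure = c.sum f := by
  rw [toMeasure, lintegral_sum_measure, sum]
  congr 1
  ext i
  split_ifs <;> simp [lintegral_dirac' _ hf]

lemma toMeasure_apply (c : PointConfig E) {B : Set E} (hB : MeasurableSet B) :
    c.toMeasure B = c.count B := by
  classical
  rw [toMeasure, Measure.sum_apply _ hB, count, ← ENNReal.tsum_set_one,
    tsum_subtype _ fun _ => (1 : ℝ≥0∞)]
  congr 1
  ext i
  by_cases h : (i : ℕ∞) < c.1 <;> simp [h, Set.indicator_apply, Measure.dirac_apply' _ hB]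

lemma measurableSet_lt_fst (i : ℕ) : MeasurableSet {c : PointConfig E | (i : ℕ∞) < c.1} :=
  measurable_fst (MeasurableSet.of_discrete (s := Set.Ioi (i : ℕ∞)))

lemma measurable_sum {f : E → ℝ≥0∞} (hf : Measurable f) :
    Measurable fun c : PointConfig E => c.sum f := by
  classical
  unfold sum
  refine Measurable.tsum fun i => Measurable.ite (measurableSet_lt_fst i) ?_ measurable_const
  exact hf.comp ((measurable_pi_apply i).comp measurable_snd)

lemma measurable_count {B : Set E} (hB : MeasurableSet B) :
    Measurable fun c : PointConfig E => c.count B := by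
  have h1 : Measurable (B.indicator (1 : E → ℝ≥0∞)) := measurable_one.indicator hB
  have h2 : Measurable fun c : PointConfig E => (c.count B : ℝ≥0∞) := by
    simp_rw [← toMeasure_apply _ hB, ← lintegral_indicator_one hB, lintegral_toMeasure _ h1]
    exact measurable_sum h1
  refine ENat.measurable_iff.2 fun n => ?_
  have h3 : (fun c : PointConfig E => c.count B) ⁻¹' {(n : ℕ∞)}
      = (fun c : PointConfig E => (c.count B : ℝ≥0∞)) ⁻¹' {((n : ℕ∞) : ℝ≥0∞)} := by
    ext c
    simp only [Set.mem_preimage, Set.mem_singleton_iff, ENat.toENNReal_inj]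
  rw [h3]
  exact h2 (measurableSet_singleton _)

end PointConfig

/-- The generating function `E[q^N] = exp (-(1 - q) m)` at `q = expNeg c`; the case `c = ∞`, `q = 0`
gives void probabilities. -/
lemma integral_expNeg_mul_poissonMeasure (m : ℝ≥0) (c : ℝ≥0∞) :
    ∫ k, expNeg (c * (k : ℝ≥0∞)) ∂(poissonMeasure m)
      = expNeg (ENNReal.ofReal (1 - expNeg c) * m) := by
  have hnn : 0 ≤ 1 - expNeg c := sub_nonneg.2 (expNeg_le_one c)
  rw [integral_poissonMeasure]
  have hk : ∀ k : ℕ, expNeg (c * (k : ℝ≥0∞)) = expNeg c ^ k := by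
    intro k
    rw [mul_comm, ← nsmul_eq_mul, ← Finset.card_range k, ← Finset.sum_const, expNeg_sum,
      Finset.prod_const]
  have h := (NormedSpace.expSeries_div_hasSum_exp ((m : ℝ) * expNeg c)).mul_left (Real.exp (-m))
  rw [← Real.exp_eq_exp_ℝ, ← Real.exp_add] at h
  have hm : (m : ℝ≥0∞) = ENNReal.ofReal m := by simp
  have hr : expNeg (ENNReal.ofReal (1 - expNeg c) * m) = Real.exp (-((1 - expNeg c) * m)) := by
    rw [hm, ← ENNReal.ofReal_mul hnn, expNeg_ofReal (mul_nonneg hnn m.coe_nonneg)]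
  have he : -((1 - expNeg c) * (m : ℝ)) = -m + m * expNeg c := by ring
  rw [hr, he, ← h.tsum_eq]
  congr 1
  ext k
  rw [hk, smul_eq_mul, mul_pow]
  ring

namespace IsPoissonProcess

variable {Ω E : Type*} [MeasurableSpace Ω] [MeasurableSpace E] {P : Measure Ω}
  [IsProbabilityMeasure P] {X : Ω → PointConfig E} {Λ : Measure E}

/-- For `c = 0` both sides are `1`, so sets of infinite intensity are harmless there; this covers
the zero level set of a simple function. -/
lemma integral_expNeg_mul_count (h : IsPoissonProcess P X Λ) {B : Set E} (hB : MeasurableSet B)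
    {c : ℝ≥0∞} (hcB : c ≠ 0 → Λ B ≠ ∞) :
    ∫ ω, expNeg (c * ((X ω).count B : ℝ≥0∞)) ∂P
      = expNeg (ENNReal.ofReal (1 - expNeg c) * Λ B) := by
  by_cases h0 : c = 0
  · simp [h0]
  have hfin := hcB h0
  have hlaw := h.count_law B hB hfin
  have := hlaw.integral_comp (f := fun n : ℕ∞ => expNeg (c * (n : ℝ≥0∞)))
    Measurable.of_discrete.aestronglyMeasurable
  simp only [Function.comp_def] at this
  rw [this, integral_map .of_discrete Measurable.of_discrete.aestronglyMeasurable]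
  simp only [ENat.toENNReal_coe]
  rw [integral_expNeg_mul_poissonMeasure, ENNReal.coe_toNNReal hfin]

/-- The level sets of `f` are disjoint, so their counts are independent and the expectation is a
product of Poisson generating functions. -/
lemma integral_expNeg_sum_simpleFunc (h : IsPoissonProcess P X Λ) (f : SimpleFunc E ℝ≥0∞)
    (hfin : ∀ c ≠ 0, Λ (f ⁻¹' {c}) ≠ ∞) :
    ∫ ω, expNeg ((X ω).sum f) ∂P
      = expNeg (∫⁻ x, ENNReal.ofReal (1 - expNeg (f x)) ∂Λ) := by
  classical
  have hsum : ∀ c : PointConfig E, c.sum f = ∑ y : f.range, (y : ℝ≥0∞) * c.count (f ⁻¹' {y.1}) := by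
    intro c
    rw [← c.lintegral_toMeasure f.measurable, SimpleFunc.lintegral_eq_lintegral,
      SimpleFunc.lintegral, ← Finset.sum_coe_sort]
    simp_rw [c.toMeasure_apply (f.measurableSet_fiber _)]
  have hint : ∫⁻ x, ENNReal.ofReal (1 - expNeg (f x)) ∂Λ
      = ∑ y : f.range, ENNReal.ofReal (1 - expNeg y) * Λ (f ⁻¹' {y.1}) := by
    have := SimpleFunc.map_lintegral (μ := Λ) (fun y => ENNReal.ofReal (1 - expNeg y)) f
    rw [← SimpleFunc.lintegral_eq_lintegral] at this
    rw [Finset.sum_coe_sort f.range (fun y => ENNReal.ofReal (1 - expNeg y) * Λ (f ⁻¹' {y})),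
      ← this]
    rfl
  let e := Fintype.equivFin f.range
  have hind : iIndepFun (fun (y : f.range) ω => (X ω).count (f ⁻¹' {y.1})) P := by
    have h1 := h.count_indep _ (fun i => f ⁻¹' {(e.symm i).1}) (fun i => f.measurableSet_fiber _)
      (fun i j hij => by
        refine Disjoint.preimage _ (Set.disjoint_singleton.2 fun hc => hij ?_)
        exact e.symm.injective (Subtype.ext hc))
    simpa using h1.precomp e.injective
  have hmeas : ∀ y : f.range, Measurable fun ω => (X ω).count (f ⁻¹' {y.1}) := fun y =>
    (PointConfig.measurable_count (f.measurableSet_fiber y.1)).comp h.measurable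
  simp_rw [hsum, hint, expNeg_sum]
  rw [hind.integral_fun_prod_comp (f := fun y (n : ℕ∞) => expNeg (y.1 * (n : ℝ≥0∞)))
    (fun y => (hmeas y).aemeasurable) (fun y => Measurable.of_discrete.aestronglyMeasurable)]
  refine Finset.prod_congr rfl fun y _ => ?_
  exact h.integral_expNeg_mul_count (f.measurableSet_fiber _) (hfin _)

/-- The Laplace functional of a Poisson process. -/
theorem integral_expNeg_sum [SigmaFinite Λ] (h : IsPoissonProcess P X Λ) {f : E → ℝ≥0∞}
    (hf : Measurable f) :
    ∫ ω, expNeg ((X ω).sum f) ∂P = expNeg (∫⁻ x, ENNReal.ofReal (1 - expNeg (f x)) ∂Λ) := by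
  -- Cutting off outside the spanning sets gives every nonzero level set finite intensity while
  -- keeping monotone convergence to `f`.
  let g : ℕ → SimpleFunc E ℝ≥0∞ := fun n =>
    (SimpleFunc.eapprox f n).restrict (spanningSets Λ n)
  have hgap : ∀ n x, g n x = (spanningSets Λ n).indicator (SimpleFunc.eapprox f n) x := fun n x =>
    SimpleFunc.restrict_apply _ (measurableSet_spanningSets Λ n) x
  have hmono : ∀ x, Monotone fun n => g n x := by
    intro x m n hmn
    simp only [hgap]
    refine (Set.indicator_le_indicator (SimpleFunc.monotone_eapprox f hmn x)).trans ?_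
    exact Set.indicator_le_indicator_of_subset (monotone_spanningSets Λ hmn) (fun _ => zero_le) x
  have hlim : ∀ x, Tendsto (fun n => g n x) atTop (𝓝 (f x)) := by
    intro x
    have h1 : Tendsto (fun n => SimpleFunc.eapprox f n x) atTop (𝓝 (f x)) := by
      rw [← SimpleFunc.iSup_eapprox_apply hf x]
      exact tendsto_atTop_iSup fun m n hmn => SimpleFunc.monotone_eapprox f hmn x
    refine h1.congr' ?_
    filter_upwards [eventually_mem_spanningSets Λ x] with n hn
    rw [hgap, Set.indicator_of_mem hn]
  have hsimple : ∀ n, ∫ ω, expNeg ((X ω).sum (g n)) ∂P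
      = expNeg (∫⁻ x, ENNReal.ofReal (1 - expNeg (g n x)) ∂Λ) := by
    intro n
    refine h.integral_expNeg_sum_simpleFunc (g n) fun c hc => ?_
    refine ((measure_mono fun x hx => ?_).trans_lt (measure_spanningSets_lt_top Λ n)).ne
    by_contra hx'
    refine hc ?_
    rw [← show g n x = c from hx, hgap, Set.indicator_of_notMem hx']
  have hleft : Tendsto (fun n => ∫ ω, expNeg ((X ω).sum (g n)) ∂P) atTop
      (𝓝 (∫ ω, expNeg ((X ω).sum f) ∂P)) := by
    refine tendsto_integral_expNeg
      (fun n => (PointConfig.measurable_sum (g n).measurable).comp h.measurable) fun ω => ?_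
    rw [← PointConfig.lintegral_toMeasure _ hf]
    simp_rw [← PointConfig.lintegral_toMeasure _ (g _).measurable]
    exact lintegral_tendsto_of_tendsto_of_monotone (fun n => (g n).measurable.aemeasurable)
      (ae_of_all _ hmono) (ae_of_all _ hlim)
  refine tendsto_nhds_unique hleft ?_
  simp_rw [hsimple]
  refine (continuous_expNeg.tendsto _).comp ?_
  refine lintegral_tendsto_of_tendsto_of_monotone (fun n => ?_) (ae_of_all _ fun x m n hmn => ?_)
    (ae_of_all _ fun x => ?_)
  · have := (g n).measurable
    fun_prop
  · exact ENNReal.ofReal_le_ofReal (sub_le_sub_left (antitone_expNeg (hmono x hmn)) 1)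
  · exact ENNReal.tendsto_ofReal (((continuous_expNeg.tendsto _).comp (hlim x)).const_sub 1)

end IsPoissonProcess

end V2X

namespace V2X

/-! ### Exponential channel gains -/

lemma integral_expMeasure_one {f : ℝ → ℝ} :
    ∫ x, f x ∂(expMeasure 1) = ∫ x in Set.Ioi (0 : ℝ), Real.exp (-x) * f x := by
  have hm : Measurable (gammaPDF 1 1) := (measurable_gammaPDFReal 1 1).ennreal_ofReal
  rw [expMeasure, gammaMeasure, integral_withDensity_eq_integral_toReal_smul hm (ae_of_all _ fun _ => ENNReal.ofReal_lt_top),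
    ← integral_Ici_eq_integral_Ioi, ← integral_indicator measurableSet_Ici]
  congr 1
  ext x
  by_cases hx : 0 ≤ x
  · have h0 : 0 ≤ Real.exp (-x) := (Real.exp_pos _).le
    simp [gammaPDF, gammaPDFReal, hx, h0]
  · simp [gammaPDF, gammaPDFReal, hx]

/-- The value `1 / (1 + c)` is written as an `expNeg`, so that products over vehicles become sums of
exponents. -/
lemma integral_expNeg_expMeasure {c : ℝ} (hc : 0 ≤ c) :
    ∫ x, expNeg (ENNReal.ofReal (c * x)) ∂(expMeasure 1)
      = expNeg (ENNReal.ofReal (Real.log (1 + c))) := by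
  rw [integral_expMeasure_one, expNeg_ofReal (Real.log_nonneg (by linarith)), Real.exp_neg,
    Real.exp_log (by linarith)]
  calc ∫ x in Set.Ioi (0 : ℝ), Real.exp (-x) * expNeg (ENNReal.ofReal (c * x))
      = ∫ x in Set.Ioi (0 : ℝ), Real.exp (-(1 + c) * x) := by
        refine setIntegral_congr_fun measurableSet_Ioi fun x hx => ?_
        rw [expNeg_ofReal (mul_nonneg hc (le_of_lt hx)), ← Real.exp_add]
        ring_nf
    _ = (1 + c)⁻¹ := by
        rw [integral_exp_mul_Ioi (by linarith)]
        rw [mul_zero, Real.exp_zero, neg_div_neg_eq, one_div]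

lemma expMeasure_real_lt_ofReal (w : ℝ≥0∞) :
    (expMeasure 1).real {x | w < ENNReal.ofReal x} = expNeg w := by
  have := isProbabilityMeasure_expMeasure one_pos
  by_cases hw : w = ∞
  · simp [hw]
  have hset : {x | w < ENNReal.ofReal x} = (Set.Iic w.toReal)ᶜ := by
    ext x
    simp [ENNReal.lt_ofReal_iff_toReal_lt hw]
  rw [hset, probReal_compl_eq_one_sub measurableSet_Iic, ← cdf_eq_real,
    cdf_expMeasure_eq one_pos, if_pos ENNReal.toReal_nonneg, expNeg_of_ne_top hw]
  simp

/-! ### Interference from a single road -/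

instance sigmaFinite_coe_smul {E : Type*} [MeasurableSpace E] (c : ℝ≥0) (μ : Measure E)
    [SigmaFinite μ] : SigmaFinite ((c : ℝ≥0∞) • μ) :=
  SMul.sigmaFinite c

/-- The interference at the origin from the vehicles `c` on the line `l`, with channel gains `h`. -/
noncomputable def lineSum (Pv α r : ℝ) (l : ℝ × ℝ) (c : PointConfig ℝ) (h : ℕ → ℝ) : ℝ≥0∞ :=
  open Classical in
  ∑' j : ℕ, if (j : ℕ∞) < c.1 ∧ r < ‖linePoint l (c.2 j)‖ then
    ENNReal.ofReal (Pv * h j * ‖linePoint l (c.2 j)‖ ^ (-α)) else 0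

/-- The interference at the origin from the vehicles `v` on the lines `l`, with channel gains
`h`. -/
noncomputable def linesSum (Pv α r : ℝ) (l : PointConfig (ℝ × ℝ)) (v : ℕ → PointConfig ℝ)
    (h : ℕ → ℕ → ℝ) : ℝ≥0∞ :=
  open Classical in
  ∑' i : ℕ, if (i : ℕ∞) < l.1 then lineSum Pv α r (l.2 i) (v i) (h i) else 0

lemma norm_linePoint (l : ℝ × ℝ) (t : ℝ) : ‖linePoint l t‖ = √(l.2 ^ 2 + t ^ 2) := by
  rw [EuclideanSpace.norm_eq]
  congr 1
  simp only [linePoint, Fin.sum_univ_two, Real.norm_eq_abs, sq_abs, PiLp.toLp_apply,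
    Matrix.cons_val_zero, Matrix.cons_val_one]
  linear_combination (l.2 ^ 2 + t ^ 2) * Real.sin_sq_add_cos_sq l.1

/-! ### Measurability of interference for an arbitrary σ-algebra, including those generated by some
of the sources -/

section Measurability

variable {X : Type*} {mX : MeasurableSpace X}

lemma measurable_norm_linePoint {l : X → ℝ × ℝ} {t : X → ℝ} (hl : Measurable l)
    (ht : Measurable t) : Measurable fun x => ‖linePoint (l x) (t x)‖ := by
  simp_rw [norm_linePoint]
  fun_prop

lemma measurable_lineSum (Pv α : ℝ) {r : X → ℝ} {l : X → ℝ × ℝ} {c : X → PointConfig ℝ}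
    {h : X → ℕ → ℝ} (hr : Measurable r) (hl : Measurable l) (hc : Measurable c)
    (hh : Measurable h) : Measurable fun x => lineSum Pv α (r x) (l x) (c x) (h x) := by
  classical
  unfold lineSum
  refine Measurable.tsum fun j => ?_
  have hn : Measurable fun x => ‖linePoint (l x) ((c x).2 j)‖ :=
    measurable_norm_linePoint hl ((measurable_pi_apply j).comp (measurable_snd.comp hc))
  have hj : Measurable fun x => h x j := (measurable_pi_apply j).comp hh
  refine Measurable.ite ?_ (by fun_prop) measurable_const
  exact (hc (PointConfig.measurableSet_lt_fst j)).inter (measurableSet_lt hr hn)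

lemma measurable_linesSum (Pv α : ℝ) {r : X → ℝ} {l : X → PointConfig (ℝ × ℝ)}
    {v : X → ℕ → PointConfig ℝ} {h : X → ℕ → ℕ → ℝ} (hr : Measurable r) (hl : Measurable l)
    (hv : Measurable v) (hh : Measurable h) :
    Measurable fun x => linesSum Pv α (r x) (l x) (v x) (h x) := by
  classical
  unfold linesSum
  refine Measurable.tsum fun i => Measurable.ite (hl (PointConfig.measurableSet_lt_fst i)) ?_
    measurable_const
  exact measurable_lineSum Pv α hr ((measurable_pi_apply i).comp (measurable_snd.comp hl))
    ((measurable_pi_apply i).comp hv) ((measurable_pi_apply i).comp hh)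

lemma measurable_curry {ι β : Type*} [MeasurableSpace β] {f : X → ι → β}
    (h : ∀ i, Measurable fun x => f x i) : Measurable f :=
  measurable_pi_iff.2 h

lemma measurable_mul_lineSum_ite (a : ℝ≥0∞) (Pv α r : ℝ) (l : ℝ × ℝ) {p : Prop} [Decidable p]
    {c : X → PointConfig ℝ} {h : X → ℕ → ℝ} (hc : Measurable c) (hh : ∀ j, Measurable fun x => h x j) :
    Measurable fun x => a * if p then lineSum Pv α r l (c x) (h x) else 0 := by
  split_ifs
  · exact (measurable_lineSum Pv α measurable_const measurable_const hc
      (measurable_curry hh)).const_mul _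
  · fun_prop

end Measurability

/-- The negative logarithm of the Laplace transform, at `s`, of the interference at distance `x`
from the origin of a single vehicle, which is ignored within the disc of radius `r`. -/
noncomputable def vehicleExponent (Pv α s r x : ℝ) : ℝ≥0∞ :=
  open Classical in if r < x then ENNReal.ofReal (Real.log (1 + s * Pv * x ^ (-α))) else 0

@[fun_prop] lemma measurable_vehicleExponent (Pv α s r : ℝ) :
    Measurable (vehicleExponent Pv α s r) := by
  classical
  exact Measurable.ite measurableSet_Ioi (by fun_prop) measurable_const

/-- The negative logarithm of the Laplace transform of the interference from the road `l`. -/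
noncomputable def roadExponent (muV : ℝ≥0) (Pv α s r : ℝ) (l : ℝ × ℝ) : ℝ≥0∞ :=
  ∫⁻ t, ENNReal.ofReal (1 - expNeg (vehicleExponent Pv α s r ‖linePoint l t‖))
    ∂((muV : ℝ≥0∞) • (volume : Measure ℝ))

lemma measurable_roadExponent (muV : ℝ≥0) (Pv α s r : ℝ) :
    Measurable (roadExponent muV Pv α s r) := by
  unfold roadExponent
  have h : Measurable fun p : (ℝ × ℝ) × ℝ => ‖linePoint p.1 p.2‖ :=
    measurable_norm_linePoint measurable_fst measurable_snd
  refine Measurable.lintegral_prod_right' (f := fun p : (ℝ × ℝ) × ℝ =>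
    ENNReal.ofReal (1 - expNeg (vehicleExponent Pv α s r ‖linePoint p.1 p.2‖))) ?_
  fun_prop

/-! ### Independence of the sources of randomness -/

namespace Network

variable {Ω : Type*} [MeasurableSpace Ω] {P : Measure Ω} {lamR muV lamB : ℝ≥0} {R : ℝ≥0∞}

/-- The `σ`-algebra generated by a source of randomness. -/
@[reducible] def sourceSpace (N : Network P lamR muV lamB R) (s : Source) : MeasurableSpace Ω :=
  match s with
    | Source.stations => MeasurableSpace.comap N.stations inferInstance
    | Source.roads => MeasurableSpace.comap N.roads inferInstance
    | Source.vehicles k => MeasurableSpace.comap (N.vehicles k) inferInstance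
    | Source.fading k j => MeasurableSpace.comap (N.fading k j) inferInstance
    | Source.link => MeasurableSpace.comap N.link inferInstance

/-- The `σ`-algebra generated by a set of sources of randomness. -/
@[reducible] def sigma (N : Network P lamR muV lamB R) (S : Set Source) : MeasurableSpace Ω :=
  ⨆ s ∈ S, N.sourceSpace s

variable (N : Network P lamR muV lamB R) {S T : Set Source}

lemma iIndep_sourceSpace : iIndep N.sourceSpace P := by
  refine (congrArg (fun m => iIndep m P) (funext fun s => ?_)).mp N.indep
  cases s <;> rfl

/-- Independence of two random variables thus reduces to checking that they are built from disjoint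
sets of source labels. -/
lemma indep_sigma (hST : Disjoint S T) : Indep (N.sigma S) (N.sigma T) P := by
  refine indep_iSup_of_disjoint (fun s => ?_) N.iIndep_sourceSpace hST
  cases s with
  | stations => exact N.stations_poisson.measurable.comap_le
  | roads => exact N.roads_poisson.measurable.comap_le
  | vehicles k => exact (N.vehicles_poisson k).measurable.comap_le
  | fading k j => exact (N.fading_measurable k j).comap_le
  | link => exact N.link_measurable.comap_le

lemma indepFun_of_measurable {E F : Type*} [MeasurableSpace E] [MeasurableSpace F]
    {X : Ω → E} {Y : Ω → F} (hST : Disjoint S T) (hX : Measurable[N.sigma S] X)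
    (hY : Measurable[N.sigma T] Y) : IndepFun X Y P :=
  (IndepFun_iff_Indep X Y P).2 (indep_of_indep_of_le_left (indep_of_indep_of_le_right
    (N.indep_sigma hST) hY.comap_le) hX.comap_le)

lemma measurable_sigma_stations (h : Source.stations ∈ S) : Measurable[N.sigma S] N.stations :=
  measurable_iff_comap_le.2 (le_iSup₂ (f := fun s _ => N.sourceSpace s) _ h)

lemma measurable_sigma_roads (h : Source.roads ∈ S) : Measurable[N.sigma S] N.roads :=
  measurable_iff_comap_le.2 (le_iSup₂ (f := fun s _ => N.sourceSpace s) _ h)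

lemma measurable_sigma_vehicles {k : Option ℕ} (h : Source.vehicles k ∈ S) :
    Measurable[N.sigma S] (N.vehicles k) :=
  measurable_iff_comap_le.2 (le_iSup₂ (f := fun s _ => N.sourceSpace s) _ h)

lemma measurable_sigma_fading {k : Option ℕ} {j : ℕ} (h : Source.fading k j ∈ S) :
    Measurable[N.sigma S] (N.fading k j) :=
  measurable_iff_comap_le.2 (le_iSup₂ (f := fun s _ => N.sourceSpace s) _ h)

lemma measurable_sigma_link (h : Source.link ∈ S) : Measurable[N.sigma S] N.link :=
  measurable_iff_comap_le.2 (le_iSup₂ (f := fun s _ => N.sourceSpace s) _ h)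

lemma measurable_fading_pi (k : Option ℕ) : Measurable fun ω j => N.fading k j ω :=
  measurable_pi_iff.2 (N.fading_measurable k)

lemma lineInterference_eq (Pv α r : ℝ) (k : Option ℕ) (l : ℝ × ℝ) (ω : Ω) :
    N.lineInterference Pv α r k l ω
      = lineSum Pv α r l (N.vehicles k ω) fun j => N.fading k j ω := rfl

lemma otherRoadsInterference_eq (Pv α r : ℝ) (ω : Ω) :
    N.otherRoadsInterference Pv α r ω = linesSum Pv α r (N.roads ω)
      (fun i => N.vehicles (some i) ω) fun i j => N.fading (some i) j ω := rfl

/-! ### Laplace transforms of the interference -/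

lemma integral_expNeg_fading (k : Option ℕ) (j : ℕ) {c : ℝ} (hc : 0 ≤ c) :
    ∫ ω, expNeg (ENNReal.ofReal (c * N.fading k j ω)) ∂P
      = expNeg (ENNReal.ofReal (Real.log (1 + c))) := by
  rw [← integral_expNeg_expMeasure hc]
  refine (N.fading_law k j).integral_comp (f := fun x => expNeg (ENNReal.ofReal (c * x))) ?_
  exact Measurable.aestronglyMeasurable (by fun_prop)

variable [IsProbabilityMeasure P]

/-- Averaging over the channel gains, for given vehicles on a given road. -/
lemma integral_expNeg_lineSum {Pv α s r : ℝ} (hPv : 0 ≤ Pv) (hs : 0 ≤ s) (k : Option ℕ)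
    (l : ℝ × ℝ) (c : PointConfig ℝ) :
    ∫ ω, expNeg (ENNReal.ofReal s * lineSum Pv α r l c fun j => N.fading k j ω) ∂P
      = expNeg (c.sum fun t => vehicleExponent Pv α s r ‖linePoint l t‖) := by
  classical
  simp_rw [lineSum, ← ENNReal.tsum_mul_left]
  have hterm : ∀ j : ℕ, Measurable fun x : ℝ => ENNReal.ofReal s *
      if (j : ℕ∞) < c.1 ∧ r < ‖linePoint l (c.2 j)‖ then
        ENNReal.ofReal (Pv * x * ‖linePoint l (c.2 j)‖ ^ (-α)) else 0 := fun j => by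
    split_ifs <;> fun_prop
  refine integral_expNeg_tsum (fun j => (hterm j).comp (N.fading_measurable k j)) (fun n => ?_)
    fun j => ?_
  -- The partial sum uses only the gains with index below `n`, the next term only the gain with
  -- index `n`.
  · refine N.indepFun_of_measurable (S := {a | ∃ i < n, a = Source.fading k i})
      (T := {Source.fading k n}) ?_ ?_ ?_
    · rw [Set.disjoint_singleton_right]
      rintro ⟨i, hi, h⟩
      exact hi.ne (by injection h with _ h; exact h.symm)
    · refine Finset.measurable_fun_sum _ fun i hi => (hterm i).comp (N.measurable_sigma_fading ?_)
      exact ⟨i, Finset.mem_range.1 hi, rfl⟩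
    · exact (hterm n).comp (N.measurable_sigma_fading rfl)
  · by_cases hj : (j : ℕ∞) < c.1
    swap
    · simp [hj]
    by_cases hr : r < ‖linePoint l (c.2 j)‖
    swap
    · simp [hr, vehicleExponent]
    simp only [hj, hr, and_self, if_true, vehicleExponent]
    rw [← N.integral_expNeg_fading k j (by positivity)]
    congr 1
    ext ω
    rw [Function.comp_apply, ← ENNReal.ofReal_mul hs]
    congr 2
    ring

/-- Gains are attached to indices, independently of positions, so averaging them out first leaves a
deterministic function summed over a Poisson process. -/
lemma integral_expNeg_lineInterference {Pv α s r : ℝ} (hPv : 0 ≤ Pv) (hs : 0 ≤ s) (k : Option ℕ)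
    (l : ℝ × ℝ) :
    ∫ ω, expNeg (ENNReal.ofReal s * N.lineInterference Pv α r k l ω) ∂P
      = expNeg (roadExponent muV Pv α s r l) := by
  have hind : IndepFun (N.vehicles k) (fun ω j => N.fading k j ω) P := by
    refine N.indepFun_of_measurable (S := {Source.vehicles k}) (T := {a | ∃ j, a = Source.fading k j})
      ?_ (N.measurable_sigma_vehicles rfl)
      (measurable_curry fun j => N.measurable_sigma_fading ⟨j, rfl⟩)
    rw [Set.disjoint_singleton_left]
    rintro ⟨j, h⟩
    cases h
  simp_rw [lineInterference_eq]
  rw [integral_expNeg_of_indepFun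
    (G := fun c h => ENNReal.ofReal s * lineSum Pv α r l c h)
    (N.vehicles_poisson k).measurable (N.measurable_fading_pi k) hind
    ((measurable_lineSum Pv α measurable_const measurable_const measurable_fst
      measurable_snd).const_mul _)
    (fun c => N.integral_expNeg_lineSum hPv hs k l c)]
  refine (N.vehicles_poisson k).integral_expNeg_sum ?_
  exact (measurable_vehicleExponent _ _ _ _).comp
    (measurable_norm_linePoint measurable_const measurable_id)

/-- Averaging over the vehicles and the channel gains, for given roads. -/
lemma integral_expNeg_linesSum {Pv α s r : ℝ} (hPv : 0 ≤ Pv) (hs : 0 ≤ s)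
    (l : PointConfig (ℝ × ℝ)) :
    ∫ ω, expNeg (ENNReal.ofReal s * linesSum Pv α r l (fun i => N.vehicles (some i) ω)
        fun i j => N.fading (some i) j ω) ∂P
      = expNeg (l.sum (roadExponent muV Pv α s r)) := by
  classical
  simp_rw [linesSum, ← ENNReal.tsum_mul_left]
  -- `G i` collects the sources attached to the `i`-th road; these sets are disjoint for different
  -- roads.
  let G : ℕ → Set Source := fun i => {a | a = Source.vehicles (some i) ∨
    ∃ j, a = Source.fading (some i) j}
  refine integral_expNeg_tsum (fun i => measurable_mul_lineSum_ite _ _ _ _ _ (N.vehicles_poisson _).measurable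
    fun j => N.fading_measurable _ _) (fun n => ?_) fun i => ?_
  · refine N.indepFun_of_measurable (S := ⋃ i < n, G i) (T := G n) ?_ ?_ ?_
    · rw [Set.disjoint_iUnion₂_left]
      intro i hi
      rw [Set.disjoint_left]
      rintro a (rfl | ⟨j, rfl⟩) (h | ⟨j', h⟩) <;> cases h <;> exact lt_irrefl _ hi
    · refine Finset.measurable_fun_sum _ fun i hi => measurable_mul_lineSum_ite _ _ _ _ _ (N.measurable_sigma_vehicles ?_)
        fun j => N.measurable_sigma_fading ?_
      · exact Set.mem_biUnion (Finset.mem_range.1 hi) (Or.inl rfl)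
      · exact Set.mem_biUnion (Finset.mem_range.1 hi) (Or.inr ⟨j, rfl⟩)
    · exact measurable_mul_lineSum_ite _ _ _ _ _ (N.measurable_sigma_vehicles (Or.inl rfl))
        fun j => N.measurable_sigma_fading (Or.inr ⟨j, rfl⟩)
  · split_ifs with hi
    · exact N.integral_expNeg_lineInterference hPv hs (some i) (l.2 i)
    · simp

instance sigmaFinite_lineIntensity : SigmaFinite (lineIntensity lamR R) := by
  unfold lineIntensity
  infer_instance

lemma integral_expNeg_otherRoadsInterference {Pv α s r : ℝ} (hPv : 0 ≤ Pv) (hs : 0 ≤ s) :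
    ∫ ω, expNeg (ENNReal.ofReal s * N.otherRoadsInterference Pv α r ω) ∂P
      = expNeg (∫⁻ l, ENNReal.ofReal (1 - expNeg (roadExponent muV Pv α s r l))
          ∂(lineIntensity lamR R)) := by
  let V : Ω → (ℕ → PointConfig ℝ) × (ℕ → ℕ → ℝ) := fun ω =>
    (fun i => N.vehicles (some i) ω, fun i j => N.fading (some i) j ω)
  have hV : Measurable V :=
    (measurable_curry fun i => (N.vehicles_poisson _).measurable).prodMk
      (measurable_curry fun i => measurable_curry fun j => N.fading_measurable _ _)
  have hind : IndepFun N.roads V P := by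
    refine N.indepFun_of_measurable (S := {Source.roads}) (T := {Source.roads}ᶜ)
      disjoint_compl_right (N.measurable_sigma_roads rfl)
      (Measurable.prodMk (measurable_curry fun i => N.measurable_sigma_vehicles ?_)
        (measurable_curry fun i => measurable_curry fun j => N.measurable_sigma_fading ?_)) <;>
    · intro h
      cases h
  simp_rw [otherRoadsInterference_eq]
  rw [integral_expNeg_of_indepFun
    (G := fun l (v : (ℕ → PointConfig ℝ) × (ℕ → ℕ → ℝ)) =>
      ENNReal.ofReal s * linesSum Pv α r l v.1 v.2) (Y := V)
    N.roads_poisson.measurable hV hind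
    ((measurable_linesSum Pv α measurable_const measurable_fst
      (measurable_fst.comp measurable_snd) (measurable_snd.comp measurable_snd)).const_mul _)
    (fun l => N.integral_expNeg_linesSum hPv hs l)]
  exact N.roads_poisson.integral_expNeg_sum (measurable_roadExponent _ _ _ _ _)

end Network

end V2X

namespace V2X

/-! ### Conditioning on an independent variable -/

section Conditioning

variable {Ω E F : Type*} [MeasurableSpace Ω] [MeasurableSpace E] [MeasurableSpace F]
  {P : Measure Ω} [IsProbabilityMeasure P] {X : Ω → E} {Y : Ω → F} {A : Set (E × F)}

/-- Fubini for the indicator of `A ∩ (B × F)` under the product law of `(X, Y)`. -/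
lemma setIntegral_measureReal_of_indepFun (hX : Measurable X) (hY : Measurable Y)
    (hXY : IndepFun X Y P) (hA : MeasurableSet A) {B : Set E} (hB : MeasurableSet B) :
    ∫ ω in X ⁻¹' B, P.real {ω' | (X ω, Y ω') ∈ A} ∂P
      = ∫ ω in X ⁻¹' B, {ω' | (X ω', Y ω') ∈ A}.indicator (fun _ => (1 : ℝ)) ω ∂P := by
  have h := integral_comp_of_indepFun hX hY hXY
    (f := fun x y => (A ∩ B ×ˢ Set.univ).indicator (fun _ => (1 : ℝ)) (x, y)) (C := 1)
    (measurable_const.indicator (hA.inter (hB.prod MeasurableSet.univ)))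
    (fun x y => (norm_indicator_le_norm_self _ _).trans (by simp))
  classical
  have e1 : ∀ ω, (X ⁻¹' B).indicator ({ω' | (X ω', Y ω') ∈ A}.indicator fun _ => (1 : ℝ)) ω
      = (A ∩ B ×ˢ Set.univ).indicator (fun _ => (1 : ℝ)) (X ω, Y ω) := fun ω => by
    by_cases h1 : X ω ∈ B <;> by_cases h2 : (X ω, Y ω) ∈ A <;> simp [h1, h2]
  have e2 : ∀ ω, (X ⁻¹' B).indicator (fun ω => P.real {ω' | (X ω, Y ω') ∈ A}) ω
      = ∫ ω', (A ∩ B ×ˢ Set.univ).indicator (fun _ => (1 : ℝ)) (X ω, Y ω') ∂P := fun ω => by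
    have hm : MeasurableSet {ω' | (X ω, Y ω') ∈ A} := (measurable_const.prodMk hY) hA
    rw [Set.indicator_apply, ← integral_indicator_one hm]
    split_ifs with h1
    · have h1' : X ω ∈ B := h1
      simp [Set.indicator_apply, h1']
    · have h1' : X ω ∉ B := h1
      simp [h1']
  rw [← integral_indicator (hX hB), ← integral_indicator (hX hB)]
  simp_rw [e1, e2]
  exact h.symm

/-- The conditional probability of an event that depends on `X` and on an independent variable
`Y`, given `X`. -/
lemma condExp_indicator_of_indepFun (hX : Measurable X) (hY : Measurable Y)
    (hXY : IndepFun X Y P) (hA : MeasurableSet A) :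
    P⟦{ω | (X ω, Y ω) ∈ A} | MeasurableSpace.comap X inferInstance⟧
      =ᵐ[P] fun ω => P.real {ω' | (X ω, Y ω') ∈ A} := by
  have hg : Measurable fun x => P.real {ω' | (x, Y ω') ∈ A} :=
    (measurable_measure_prodMk_left (ν := P)
      ((measurable_fst.prodMk (hY.comp measurable_snd)) hA)).ennreal_toReal
  refine (ae_eq_condExp_of_forall_setIntegral_eq hX.comap_le ?_ ?_ ?_ ?_).symm
  · exact (integrable_const (1 : ℝ)).indicator ((hX.prodMk hY) hA)
  · intro s _ _
    refine (Integrable.of_bound (hg.comp hX).aestronglyMeasurable 1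
      (ae_of_all _ fun ω => ?_)).integrableOn
    rw [Function.comp_apply, Real.norm_of_nonneg measureReal_nonneg]
    exact measureReal_le_one
  · rintro s ⟨B, hB, rfl⟩ _
    exact setIntegral_measureReal_of_indepFun hX hY hXY hA hB
  · exact (hg.comp (comap_measurable X)).aestronglyMeasurable

end Conditioning

namespace IsPoissonProcess

variable {Ω E : Type*} [MeasurableSpace Ω] [MeasurableSpace E] {P : Measure Ω}
  [IsProbabilityMeasure P] {X : Ω → PointConfig E} {Λ : Measure E}

/-- The void probabilities of a Poisson process: the integrand is the indicator function of the
event that there is no point in `B`. -/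
lemma integral_expNeg_sum_indicator_top [SigmaFinite Λ] (h : IsPoissonProcess P X Λ) {B : Set E}
    (hB : MeasurableSet B) :
    ∫ ω, expNeg ((X ω).sum (B.indicator fun _ => ∞)) ∂P = expNeg (Λ B) := by
  rw [h.integral_expNeg_sum (measurable_const.indicator hB), ← lintegral_indicator_one hB]
  congr 2
  ext x
  by_cases hx : x ∈ B <;> simp [hx]

end IsPoissonProcess

namespace Network

variable {Ω : Type*} [MeasurableSpace Ω] {P : Measure Ω} {lamR muV lamB : ℝ≥0} {R : ℝ≥0∞}
  (N : Network P lamR muV lamB R)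

/-! ### The distance to the nearest base station -/

/-- The distance is a countable infimum over indices, where absent points count as `∞`. -/
lemma measurable_infDist_points (x : Plane) :
    Measurable fun c : PointConfig Plane => Metric.infDist x c.points := by
  classical
  have h : ∀ c : PointConfig Plane, Metric.infEDist x c.points
      = ⨅ i : ℕ, if (i : ℕ∞) < c.1 then edist x (c.2 i) else ∞ := by
    intro c
    refine le_antisymm (le_iInf fun i => ?_) (le_iInf₂ fun y hy => ?_)
    · split_ifs with hi
      · exact Metric.infEDist_le_edist_of_mem ⟨i, hi, rfl⟩
      · exact le_top
    · obtain ⟨i, hi, rfl⟩ := hy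
      exact (iInf_le _ i).trans (by simp [hi])
  unfold Metric.infDist
  simp_rw [h]
  refine (Measurable.iInf fun i => Measurable.ite (PointConfig.measurableSet_lt_fst i) ?_
    measurable_const).ennreal_toReal
  exact measurable_const.edist ((measurable_pi_apply i).comp measurable_snd)

lemma measurable_nearestStationDist : Measurable N.nearestStationDist :=
  (measurable_infDist_points N.transmitter).comp N.stations_poisson.measurable

/-- The plane has infinite intensity, so its void probability is `exp (-∞) = 0`. The case matters
because `Metric.infDist` to the empty set is `0`. -/
lemma ae_points_nonempty [IsProbabilityMeasure P] (hlamB : 0 < lamB) : ∀ᵐ ω ∂P, (N.stations ω).points.Nonempty := by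
  have h := N.stations_poisson.integral_expNeg_sum_indicator_top MeasurableSet.univ
  have hm : Measurable fun ω => (N.stations ω).sum (Set.univ.indicator fun _ => ∞) :=
    (PointConfig.measurable_sum (measurable_const.indicator MeasurableSet.univ)).comp
      N.stations_poisson.measurable
  have htop : ((lamB : ℝ≥0∞) • (volume : Measure Plane)) Set.univ = ∞ := by
    rw [Measure.smul_apply, measure_univ_of_isAddLeftInvariant, smul_eq_mul,
      ENNReal.mul_top (by simpa using hlamB.ne')]
  rw [htop, expNeg_top, integral_eq_zero_iff_of_nonneg (fun _ => expNeg_nonneg _)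
    (integrable_expNeg hm)] at h
  filter_upwards [h] with ω hω
  by_contra hne
  have hzero : (N.stations ω).sum (Set.univ.indicator fun _ => ∞) = 0 := by
    refine ENNReal.tsum_eq_zero.2 fun i => if_neg fun hi => hne ⟨_, i, hi, rfl⟩
  rw [hzero, expNeg_zero] at hω
  exact one_ne_zero hω

/-- On this event some station lies in the ball, so the sum with weight `∞` on the ball is infinite
and its `expNeg` vanishes; the bound is one minus the void probability. -/
lemma measureReal_exists_mem_ball_le [IsProbabilityMeasure P] (ε : ℝ) :
    P.real {ω | (N.stations ω).points.Nonempty ∧ N.nearestStationDist ω < ε}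
      ≤ 1 - expNeg (lamB * volume (Metric.ball N.transmitter ε)) := by
  have hm : Measurable fun ω => (N.stations ω).sum
      ((Metric.ball N.transmitter ε).indicator fun _ => ∞) :=
    (PointConfig.measurable_sum (measurable_const.indicator measurableSet_ball)).comp
      N.stations_poisson.measurable
  have h := N.stations_poisson.integral_expNeg_sum_indicator_top
    (measurableSet_ball (x := N.transmitter) (ε := ε))
  rw [Measure.smul_apply, smul_eq_mul] at h
  have hint := integrable_expNeg (P := P) hm
  have hset : MeasurableSet {ω | expNeg ((N.stations ω).sum
      ((Metric.ball N.transmitter ε).indicator fun _ => ∞)) ≤ 0} :=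
    measurableSet_le (measurable_expNeg.comp hm) measurable_const
  have hle : P.real {ω | expNeg ((N.stations ω).sum
      ((Metric.ball N.transmitter ε).indicator fun _ => ∞)) ≤ 0}
      ≤ ∫ ω, (1 - expNeg ((N.stations ω).sum
      ((Metric.ball N.transmitter ε).indicator fun _ => ∞))) ∂P := by
    rw [← integral_indicator_one hset]
    refine integral_mono ((integrable_const _).indicator hset) ((integrable_const _).sub hint) fun ω => ?_
    refine Set.indicator_apply_le' (fun hω => ?_) fun _ => sub_nonneg.2 (expNeg_le_one _)
    have : expNeg _ ≤ 0 := hω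
    simp only [Pi.one_apply]
    linarith
  rw [integral_sub (integrable_const _) hint, h] at hle
  simp only [integral_const, probReal_univ, smul_eq_mul, mul_one] at hle
  refine (measureReal_mono fun ω hω => ?_).trans hle
  obtain ⟨_, ⟨i, hi, rfl⟩, hx⟩ := (Metric.infDist_lt_iff hω.1).1 hω.2
  have htop : (N.stations ω).sum ((Metric.ball N.transmitter ε).indicator fun _ => ∞) = ∞ := by
    refine ENNReal.tsum_eq_top_of_eq_top ⟨i, ?_⟩
    rw [if_pos hi, Set.indicator_of_mem]
    rwa [Metric.mem_ball, dist_comm]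
  simp [htop]

/-- A station at distance `0` lies in every ball of radius `ε`, an event of probability at most `1 -
exp (-lamB π ε²)`, which tends to `0`. -/
lemma ae_nearestStationDist_pos [IsProbabilityMeasure P] (hlamB : 0 < lamB) : ∀ᵐ ω ∂P, 0 < N.nearestStationDist ω := by
  have hlim : Tendsto (fun ε : ℝ => 1 - expNeg (lamB * volume (Metric.ball N.transmitter ε)))
      (𝓝[>] 0) (𝓝 0) := by
    have h0 : Tendsto (fun ε : ℝ => (lamB : ℝ≥0∞) * volume (Metric.ball N.transmitter ε))
        (𝓝[>] 0) (𝓝 0) := by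
      simp_rw [EuclideanSpace.volume_ball_fin_two]
      have : Tendsto (fun ε : ℝ => ENNReal.ofReal (lamB * (ε ^ 2 * Real.pi))) (𝓝 0)
          (𝓝 (ENNReal.ofReal (lamB * ((0 : ℝ) ^ 2 * Real.pi)))) :=
        (ENNReal.continuous_ofReal.comp (by fun_prop)).tendsto _
      simp only [ne_eq, OfNat.ofNat_ne_zero, not_false_eq_true, zero_pow, zero_mul, mul_zero,
        ENNReal.ofReal_zero] at this
      refine (this.mono_left nhdsWithin_le_nhds).congr' ?_
      filter_upwards [self_mem_nhdsWithin] with ε hε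
      have hε' : (0 : ℝ) ≤ ε := le_of_lt hε
      rw [ENNReal.ofReal_mul lamB.coe_nonneg, ENNReal.ofReal_coe_nnreal,
        ENNReal.ofReal_mul (by positivity), ENNReal.ofReal_pow hε']
    have := ((continuous_expNeg.tendsto _).comp h0).const_sub 1
    simpa using this
  have hle : P.real {ω | (N.stations ω).points.Nonempty ∧ N.nearestStationDist ω ≤ 0} ≤ 0 := by
    refine ge_of_tendsto hlim ?_
    filter_upwards [self_mem_nhdsWithin] with ε hε
    refine le_trans (measureReal_mono fun ω hω => ?_) (N.measureReal_exists_mem_ball_le ε)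
    exact ⟨hω.1, hω.2.trans_lt hε⟩
  have hnull : ∀ᵐ ω ∂P, ¬((N.stations ω).points.Nonempty ∧ N.nearestStationDist ω ≤ 0) := by
    rw [ae_iff]
    simp only [not_not]
    exact (measureReal_eq_zero_iff).1 (le_antisymm hle measureReal_nonneg)
  filter_upwards [hnull, N.ae_points_nonempty hlamB] with ω h1 h2
  by_contra h3
  exact h1 ⟨h2, not_lt.1 h3⟩

/-! ### The success probability -/

/-- All sources of randomness except the base stations. -/
abbrev Signals : Type :=
  PointConfig (ℝ × ℝ) × (Option ℕ → PointConfig ℝ) × (Option ℕ → ℕ → ℝ) × ℝ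

/-- The sources of randomness except the base stations, as a random variable. -/
def signals (ω : Ω) : Signals :=
  (N.roads ω, fun k => N.vehicles k ω, fun k j => N.fading k j ω, N.link ω)

/-- The SINR as a function of the distance and of the sources of randomness. -/
noncomputable def sinrOf (Pv α σ2 θ r : ℝ) (w : Signals) : ℝ≥0∞ :=
  ENNReal.ofReal (Pv * r ^ (-α) * w.2.2.2) /
    (linesSum Pv α r w.1 (fun i => w.2.1 (some i)) (fun i => w.2.2.1 (some i)) +
      lineSum Pv α r (θ, 0) (w.2.1 none) (w.2.2.1 none) + ENNReal.ofReal σ2)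

/-- Joint measurability in the distance is needed because `r` is later replaced by the random
distance to the nearest station. -/
lemma measurable_sinrOf (Pv α σ2 θ : ℝ) :
    Measurable fun p : ℝ × Signals => sinrOf Pv α σ2 θ p.1 p.2 := by
  unfold sinrOf
  refine Measurable.div (by fun_prop) (Measurable.add (Measurable.add ?_ ?_) measurable_const)
  · refine measurable_linesSum Pv α measurable_fst (by fun_prop) ?_ ?_
    · exact measurable_curry fun i => by fun_prop
    · exact measurable_curry fun i => by fun_prop
  · exact measurable_lineSum Pv α measurable_fst measurable_const (by fun_prop) (by fun_prop)

lemma measurable_sigma_signals {S : Set Source} (hS : ∀ s, s ≠ Source.stations → s ∈ S) :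
    Measurable[N.sigma S] N.signals :=
  (N.measurable_sigma_roads (hS _ (by simp))).prodMk
    ((measurable_curry fun k => N.measurable_sigma_vehicles (hS _ (by simp))).prodMk
      ((measurable_curry fun k => measurable_curry fun j =>
        N.measurable_sigma_fading (hS _ (by simp))).prodMk
        (N.measurable_sigma_link (hS _ (by simp)))))

lemma measurable_signals : Measurable N.signals :=
  N.roads_poisson.measurable.prodMk
    ((measurable_curry fun k => (N.vehicles_poisson k).measurable).prodMk
      ((measurable_curry fun k => measurable_curry fun j =>
        N.fading_measurable k j).prodMk N.link_measurable))

lemma indepFun_nearestStationDist_signals : IndepFun N.nearestStationDist N.signals P :=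
  N.indepFun_of_measurable (S := {Source.stations}) (T := {Source.stations}ᶜ) disjoint_compl_right
    ((measurable_infDist_points N.transmitter).comp (N.measurable_sigma_stations rfl))
    (N.measurable_sigma_signals fun _ h => h)

lemma sinr_eq (Pv α σ2 r : ℝ) (ω : Ω) :
    N.sinr Pv α σ2 r ω = sinrOf Pv α σ2 N.angle r (N.signals ω) := rfl

/-- Conditionally on the distance to the nearest base station, the success probability is the
one for a fixed distance. -/
lemma condExp_sinr_nearestStationDist [IsProbabilityMeasure P] (Pv α σ2 z : ℝ) :
    P⟦{ω | ENNReal.ofReal z < N.sinr Pv α σ2 (N.nearestStationDist ω) ω} |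
      MeasurableSpace.comap N.nearestStationDist inferInstance⟧
      =ᵐ[P] fun ω => P.real {ω' | ENNReal.ofReal z <
        N.sinr Pv α σ2 (N.nearestStationDist ω) ω'} := by
  simp_rw [sinr_eq]
  exact condExp_indicator_of_indepFun
    (A := {p : ℝ × Signals | ENNReal.ofReal z < sinrOf Pv α σ2 N.angle p.1 p.2})
    N.measurable_nearestStationDist N.measurable_signals N.indepFun_nearestStationDist_signals
    (measurableSet_lt measurable_const (measurable_sinrOf _ _ _ _))

section FixedDistance

variable {S : Set Source} {Pv α r : ℝ}

lemma measurable_sigma_otherRoadsInterference (hroads : Source.roads ∈ S)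
    (hveh : ∀ i, Source.vehicles (some i) ∈ S) (hfad : ∀ i j, Source.fading (some i) j ∈ S) :
    Measurable[N.sigma S] (N.otherRoadsInterference Pv α r) :=
  measurable_linesSum Pv α measurable_const (N.measurable_sigma_roads hroads)
    (measurable_curry fun i => N.measurable_sigma_vehicles (hveh i))
    (measurable_curry fun i => measurable_curry fun j => N.measurable_sigma_fading (hfad i j))

lemma measurable_sigma_typicalRoadInterference (hveh : Source.vehicles none ∈ S)
    (hfad : ∀ j, Source.fading none j ∈ S) :
    Measurable[N.sigma S] (N.typicalRoadInterference Pv α r) :=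
  measurable_lineSum Pv α measurable_const measurable_const (N.measurable_sigma_vehicles hveh)
    (measurable_curry fun j => N.measurable_sigma_fading (hfad j))

lemma measurable_otherRoadsInterference : Measurable (N.otherRoadsInterference Pv α r) :=
  measurable_linesSum Pv α measurable_const N.roads_poisson.measurable
    (measurable_curry fun _ => (N.vehicles_poisson _).measurable)
    (measurable_curry fun _ => measurable_curry fun _ => N.fading_measurable _ _)

lemma measurable_typicalRoadInterference : Measurable (N.typicalRoadInterference Pv α r) :=
  measurable_lineSum Pv α measurable_const measurable_const (N.vehicles_poisson _).measurable
    (measurable_curry fun _ => N.fading_measurable _ _)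

lemma indepFun_interference :
    IndepFun (N.otherRoadsInterference Pv α r) (N.typicalRoadInterference Pv α r) P := by
  let T : Set Source := {a | a = Source.vehicles none ∨ ∃ j, a = Source.fading none j}
  refine N.indepFun_of_measurable (S := Tᶜ) (T := T) disjoint_compl_left
    (N.measurable_sigma_otherRoadsInterference ?_ ?_ ?_)
    (N.measurable_sigma_typicalRoadInterference (Or.inl rfl) fun j => Or.inr ⟨j, rfl⟩) <;>
  simp [T]

/-- Freeze `Y`, which does not involve the link gain, and use the exponential tail. -/
lemma measureReal_lt_ofReal_link [IsProbabilityMeasure P] {Y : Ω → ℝ≥0∞} (hYm : Measurable Y)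
    (hY : Measurable[N.sigma {Source.link}ᶜ] Y) :
    P.real {ω | Y ω < ENNReal.ofReal (N.link ω)} = ∫ ω, expNeg (Y ω) ∂P := by
  have hset : MeasurableSet {p : ℝ≥0∞ × ℝ | p.1 < ENNReal.ofReal p.2} :=
    measurableSet_lt measurable_fst measurable_snd.ennreal_ofReal
  have h := setIntegral_measureReal_of_indepFun hYm N.link_measurable
    (N.indepFun_of_measurable disjoint_compl_left hY (N.measurable_sigma_link rfl)) hset
    MeasurableSet.univ
  rw [Set.preimage_univ, setIntegral_univ, setIntegral_univ] at h
  have hset' : MeasurableSet {ω | Y ω < ENNReal.ofReal (N.link ω)} :=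
    (hYm.prodMk N.link_measurable) hset
  rw [← integral_indicator_one hset']
  refine Eq.trans (Eq.symm h) (integral_congr_ae (ae_of_all _ fun ω => ?_))
  have hm : MeasurableSet {x : ℝ | Y ω < ENNReal.ofReal x} :=
    measurableSet_lt measurable_const measurable_id.ennreal_ofReal
  exact (N.link_law.measureReal_eq hm).trans (expMeasure_real_lt_ofReal (Y ω))

lemma lt_sinr_iff {σ2 z : ℝ} (hPv : 0 < Pv) (hr : 0 < r) (hz : 0 < z) (ω : Ω) :
    ENNReal.ofReal z < N.sinr Pv α σ2 r ω ↔
      ENNReal.ofReal (z / (Pv * r ^ (-α))) * (N.otherRoadsInterference Pv α r ω +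
        N.typicalRoadInterference Pv α r ω + ENNReal.ofReal σ2) < ENNReal.ofReal (N.link ω) := by
  have ha : 0 < Pv * r ^ (-α) := by positivity
  rw [sinr]
  generalize N.otherRoadsInterference Pv α r ω + N.typicalRoadInterference Pv α r ω
    + ENNReal.ofReal σ2 = D
  -- As `0 < z < ∞`, clearing the denominator is valid even when `D` is `0` or `∞`.
  rw [ENNReal.lt_div_iff_mul_lt (Or.inr ENNReal.ofReal_ne_top)
    (Or.inr (ENNReal.ofReal_pos.2 hz).ne'), ENNReal.ofReal_mul ha.le, ENNReal.ofReal_div_of_pos ha]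
  set a := ENNReal.ofReal (Pv * r ^ (-α))
  have ha0 : a ≠ 0 := by simpa [a] using ha
  have hat : a ≠ ∞ := ENNReal.ofReal_ne_top
  rw [mul_comm a, ← ENNReal.div_lt_iff (Or.inl ha0) (Or.inl hat), ENNReal.mul_div_right_comm]

theorem measureReal_lt_sinr [IsProbabilityMeasure P] {σ2 z : ℝ} (hPv : 0 < Pv) (hσ2 : 0 ≤ σ2) (hr : 0 < r) (hz : 0 < z) :
    P.real {ω | ENNReal.ofReal z < N.sinr Pv α σ2 r ω} =
      Real.exp (-(z * σ2 / (Pv * r ^ (-α)))) *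
        laplaceTransform P (N.otherRoadsInterference Pv α r) (z / (Pv * r ^ (-α))) *
        laplaceTransform P (N.typicalRoadInterference Pv α r) (z / (Pv * r ^ (-α))) := by
  simp_rw [N.lt_sinr_iff hPv hr hz]
  set s := z / (Pv * r ^ (-α)) with hs
  have hs0 : 0 ≤ s := by positivity
  have hmo := N.measurable_otherRoadsInterference (Pv := Pv) (α := α) (r := r)
  have hmt := N.measurable_typicalRoadInterference (Pv := Pv) (α := α) (r := r)
  rw [N.measureReal_lt_ofReal_link]
  · simp_rw [mul_add, expNeg_add, ← expNeg_add]
    -- Only the constant noise factor is split off; the two interferences stay in one exponent, as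
    -- `integral_expNeg_add` requires.
    simp_rw [expNeg_add _ (ENNReal.ofReal s * ENNReal.ofReal σ2)]
    rw [integral_mul_const, integral_expNeg_add (hmo.const_mul _) (hmt.const_mul _)
      (N.indepFun_interference.comp (measurable_const_mul _) (measurable_const_mul _)),
      ← ENNReal.ofReal_mul hs0, expNeg_ofReal (by positivity), laplaceTransform,
      laplaceTransform, hs]
    ring_nf
  · exact ((hmo.add hmt).add_const _).const_mul _
  · refine Measurable.const_mul (Measurable.add_const (Measurable.add ?_ ?_) _) _
    · exact N.measurable_sigma_otherRoadsInterference (by simp) (by simp) (by simp)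
    · exact N.measurable_sigma_typicalRoadInterference (by simp) (by simp)

end FixedDistance

end Network

end V2X

namespace V2X

/-! ### The Laplace transform of the interference from a single road -/

section Road

variable {Pv α s r : ℝ}

lemma vehicleExponent_of_lt {x : ℝ} (h : r < x) :
    vehicleExponent Pv α s r x = ENNReal.ofReal (Real.log (1 + s * Pv * x ^ (-α))) := if_pos h

lemma vehicleExponent_of_le {x : ℝ} (h : x ≤ r) : vehicleExponent Pv α s r x = 0 :=
  if_neg (not_lt.2 h)

/-- One minus the Laplace transform of the interference from a single vehicle, at signed
displacement `t` on a road at distance `|y|` from the origin. -/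
noncomputable def vehicleLoss (Pv α s r y t : ℝ) : ℝ :=
  1 - expNeg (vehicleExponent Pv α s r √(y ^ 2 + t ^ 2))

lemma roadExponent_eq_lintegral (muV : ℝ≥0) (l : ℝ × ℝ) :
    roadExponent muV Pv α s r l = muV * ∫⁻ t, ENNReal.ofReal (vehicleLoss Pv α s r l.2 t) := by
  simp only [roadExponent, norm_linePoint, lintegral_smul_measure, vehicleLoss, smul_eq_mul]

lemma vehicleLoss_nonneg (y t : ℝ) : 0 ≤ vehicleLoss Pv α s r y t :=
  sub_nonneg.2 (expNeg_le_one _)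

lemma measurable_vehicleLoss : Measurable fun p : ℝ × ℝ => vehicleLoss Pv α s r p.1 p.2 := by
  unfold vehicleLoss
  fun_prop

lemma sqrt_rpow_neg {x : ℝ} (hx : 0 ≤ x) : √x ^ (-α) = x ^ (-α / 2) := by
  rw [Real.sqrt_eq_rpow, ← Real.rpow_mul hx]
  ring_nf

lemma vehicleLoss_eq (hs : 0 ≤ s * Pv) {y t : ℝ} (h : r < √(y ^ 2 + t ^ 2)) :
    vehicleLoss Pv α s r y t = 1 - 1 / (1 + s * Pv * (y ^ 2 + t ^ 2) ^ (-α / 2)) := by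
  have h0 : 0 ≤ y ^ 2 + t ^ 2 := by positivity
  have h1 : 0 ≤ s * Pv * (y ^ 2 + t ^ 2) ^ (-α / 2) := by positivity
  rw [vehicleLoss, vehicleExponent_of_lt h, sqrt_rpow_neg h0,
    expNeg_ofReal (Real.log_nonneg (by linarith)), Real.exp_neg, Real.exp_log (by linarith),
    one_div]

/-- Inside the disc the loss is `0`. Outside, `1 - 1 / (1 + w) ≤ w`, and `r² < y² + t²` gives `1 + m
≤ (1 + 1 / r²) (y² + t²)`. The free `m` lets the bound serve with the norm of `ℝ` and with the sup
norm of `ℝ × ℝ`. -/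
lemma vehicleLoss_le (hs : 0 ≤ s * Pv) (hα : 0 ≤ α) (hr : 0 < r) {y t m : ℝ} (hm : 0 ≤ m)
    (hmle : m ≤ y ^ 2 + t ^ 2) :
    vehicleLoss Pv α s r y t ≤ s * Pv * (1 + 1 / r ^ 2) ^ (α / 2) * (1 + m) ^ (-α / 2) := by
  by_cases h : r < √(y ^ 2 + t ^ 2)
  swap
  · rw [vehicleLoss, vehicleExponent_of_le (not_lt.1 h), expNeg_zero, sub_self]
    positivity
  rw [vehicleLoss_eq hs h]
  set x := y ^ 2 + t ^ 2 with hx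
  have hr2 : r ^ 2 < x := (Real.lt_sqrt hr.le).1 h
  have hx0 : 0 < x := (by positivity : 0 < r ^ 2).trans hr2
  have hw : 0 ≤ s * Pv * x ^ (-α / 2) := by positivity
  have h1 : 1 - 1 / (1 + s * Pv * x ^ (-α / 2)) ≤ s * Pv * x ^ (-α / 2) := by
    rw [sub_le_iff_le_add, ← sub_le_iff_le_add', le_div_iff₀ (by linarith)]
    nlinarith
  have h2 : 1 + m ≤ (1 + 1 / r ^ 2) * x := by
    have : 1 ≤ 1 / r ^ 2 * x := by
      rw [one_div, inv_mul_eq_div, one_le_div (by positivity)]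
      exact hr2.le
    linarith
  have h3 : x ^ (-α / 2) ≤ (1 + 1 / r ^ 2) ^ (α / 2) * (1 + m) ^ (-α / 2) := by
    calc x ^ (-α / 2)
        = (1 + 1 / r ^ 2) ^ (α / 2) * ((1 + 1 / r ^ 2) * x) ^ (-α / 2) := by
          rw [Real.mul_rpow (by positivity) hx0.le, ← mul_assoc, ← Real.rpow_add (by positivity)]
          ring_nf
          simp
      _ ≤ _ := by
          gcongr ?_ * ?_
          exact Real.rpow_le_rpow_of_nonpos (by linarith) h2 (by linarith)
  calc _ ≤ s * Pv * x ^ (-α / 2) := h1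
    _ ≤ s * Pv * ((1 + 1 / r ^ 2) ^ (α / 2) * (1 + m) ^ (-α / 2)) := by gcongr
    _ = _ := by ring

lemma integrable_vehicleLoss (hs : 0 ≤ s * Pv) (hα : 1 < α) (hr : 0 < r) (y : ℝ) :
    Integrable fun t => vehicleLoss Pv α s r y t := by
  refine Integrable.mono' ((integrable_rpow_neg_one_add_norm_sq (E := ℝ) (μ := volume)
    (r := α) (by simpa using hα)).const_mul (s * Pv * (1 + 1 / r ^ 2) ^ (α / 2)))
    (measurable_vehicleLoss.comp measurable_prodMk_left).aestronglyMeasurable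
    (ae_of_all _ fun t => ?_)
  rw [Real.norm_of_nonneg (vehicleLoss_nonneg y t)]
  refine vehicleLoss_le hs (by linarith) hr (by positivity) ?_
  rw [Real.norm_eq_abs, sq_abs]
  nlinarith [sq_nonneg y]

/-- The iterated integral is a planar one, dominated by a multiple of `(1 + ‖p‖²)^(-α/2)`, which is
integrable in dimension two exactly because `α > 2`. -/
lemma lintegral_vehicleLoss_lt_top (hs : 0 ≤ s * Pv) (hα : 2 < α) (hr : 0 < r) :
    ∫⁻ y, ∫⁻ t, ENNReal.ofReal (vehicleLoss Pv α s r y t) < ∞ := by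
  have hm := measurable_vehicleLoss (Pv := Pv) (α := α) (s := s) (r := r)
  rw [← lintegral_prod (μ := volume) (ν := volume)
    (fun p : ℝ × ℝ => ENNReal.ofReal (vehicleLoss Pv α s r p.1 p.2))
    hm.ennreal_ofReal.aemeasurable]
  have hint : Integrable (fun p : ℝ × ℝ => vehicleLoss Pv α s r p.1 p.2)
      (volume.prod volume) := by
    refine Integrable.mono' ((integrable_rpow_neg_one_add_norm_sq (E := ℝ × ℝ)
      (μ := volume.prod volume) (r := α) (by simpa using hα)).const_mul
        (s * Pv * (1 + 1 / r ^ 2) ^ (α / 2))) hm.aestronglyMeasurable (ae_of_all _ fun p => ?_)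
    rw [Real.norm_of_nonneg (vehicleLoss_nonneg _ _)]
    refine vehicleLoss_le hs (by linarith) hr (by positivity) ?_
    rw [Prod.norm_def]
    rcases max_choice ‖p.1‖ ‖p.2‖ with h | h <;> rw [h, Real.norm_eq_abs, sq_abs] <;>
      nlinarith [sq_nonneg p.1, sq_nonneg p.2]
  rw [← ofReal_integral_eq_lintegral_ofReal hint (ae_of_all _ fun p => vehicleLoss_nonneg _ _)]
  exact ENNReal.ofReal_lt_top

/-- The loss is even in `t` and vanishes inside the disc. Since `√` of a negative number is `0`, the
formula also covers roads that miss the disc. -/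
lemma integral_vehicleLoss (hs : 0 ≤ s * Pv) (hr : 0 < r) (y : ℝ) :
    ∫ t, vehicleLoss Pv α s r y t = 2 * ∫ t in Set.Ioi √(r ^ 2 - y ^ 2),
      (1 - 1 / (1 + s * Pv * (y ^ 2 + t ^ 2) ^ (-α / 2))) := by
  have habs : ∀ t, vehicleLoss Pv α s r y t = vehicleLoss Pv α s r y |t| := fun t => by
    rw [vehicleLoss, vehicleLoss, sq_abs]
  rw [integral_congr_ae (ae_of_all _ habs), integral_comp_abs]
  congr 1
  have hiff : ∀ {t : ℝ}, 0 < t → (√(r ^ 2 - y ^ 2) < t ↔ r < √(y ^ 2 + t ^ 2)) := fun ht => by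
    rw [Real.sqrt_lt' ht, Real.lt_sqrt hr.le, sub_lt_iff_lt_add']
  have hsub : Set.Ioi √(r ^ 2 - y ^ 2) ⊆ Set.Ioi 0 := Set.Ioi_subset_Ioi (Real.sqrt_nonneg _)
  rw [setIntegral_eq_of_subset_of_forall_sdiff_eq_zero measurableSet_Ioi hsub]
  · refine setIntegral_congr_fun measurableSet_Ioi fun t ht => ?_
    exact vehicleLoss_eq hs ((hiff (hsub ht)).1 ht)
  · intro t ht
    have h : ¬ r < √(y ^ 2 + t ^ 2) := fun h => ht.2 ((hiff ht.1).2 h)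
    rw [vehicleLoss, vehicleExponent_of_le (not_lt.1 h), expNeg_zero, sub_self]

lemma expNeg_roadExponent (muV : ℝ≥0) (hs : 0 ≤ s * Pv) (hα : 1 < α) (hr : 0 < r) (l : ℝ × ℝ) :
    expNeg (roadExponent muV Pv α s r l) = laplaceRoadIn muV Pv α s r l.2 := by
  have hnn : 0 ≤ ∫ t, vehicleLoss Pv α s r l.2 t := integral_nonneg fun t => vehicleLoss_nonneg _ _
  rw [roadExponent_eq_lintegral, ← ofReal_integral_eq_lintegral_ofReal
    (integrable_vehicleLoss hs hα hr l.2) (ae_of_all _ fun t => vehicleLoss_nonneg _ _),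
    ← ENNReal.ofReal_coe_nnreal, ← ENNReal.ofReal_mul muV.coe_nonneg,
    expNeg_ofReal (mul_nonneg muV.coe_nonneg hnn), integral_vehicleLoss hs hr, laplaceRoadIn]
  ring_nf

lemma laplaceRoadIn_of_le {muV y : ℝ} (hr : 0 < r) (h : r ≤ y) :
    laplaceRoadIn muV Pv α s r y = laplaceRoadOut muV Pv α s y := by
  rw [laplaceRoadIn, laplaceRoadOut, Real.sqrt_eq_zero_of_nonpos]
  nlinarith

lemma laplaceRoadIn_abs (muV y : ℝ) :
    laplaceRoadIn muV Pv α s r |y| = laplaceRoadIn muV Pv α s r y := by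
  simp only [laplaceRoadIn, sq_abs]

end Road

/-! ### The Laplace transform of the interference from all other roads -/

lemma lintegral_lineIntensity (lamR : ℝ≥0) (R : ℝ≥0∞) {f : ℝ → ℝ≥0∞} (hf : Measurable f) :
    ∫⁻ l, f l.2 ∂(lineIntensity lamR R)
      = lamR * (ENNReal.ofReal Real.pi * ∫⁻ y in {y : ℝ | ENNReal.ofReal |y| ≤ R}, f y) := by
  rw [lineIntensity, lintegral_smul_measure, Measure.volume_eq_prod, ← Measure.prod_restrict,
    smul_eq_mul]
  congr 1
  have h := lintegral_prod_mul (μ := volume.restrict (Set.Icc 0 Real.pi))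
    (ν := volume.restrict {y : ℝ | ENNReal.ofReal |y| ≤ R}) (f := fun _ => 1) (g := f)
    aemeasurable_const hf.aemeasurable
  simpa using h

section OtherRoads

variable {Pv α s r : ℝ} {R : ℝ≥0∞}

lemma measurableSet_ofReal_abs_le (R : ℝ≥0∞) : MeasurableSet {y : ℝ | ENNReal.ofReal |y| ≤ R} :=
  measurableSet_le (by fun_prop) measurable_const

lemma measurable_laplaceRoadIn (muV : ℝ≥0) (hs : 0 ≤ s * Pv) (hα : 1 < α) (hr : 0 < r) :
    Measurable fun y => laplaceRoadIn muV Pv α s r y := by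
  have h : (fun y => laplaceRoadIn muV Pv α s r y)
      = fun y => expNeg (roadExponent muV Pv α s r (0, y)) :=
    funext fun y => (expNeg_roadExponent muV hs hα hr (0, y)).symm
  rw [h]
  have := measurable_roadExponent muV Pv α s r
  fun_prop

lemma one_sub_laplaceRoadIn_nonneg (muV : ℝ≥0) (hs : 0 ≤ s * Pv) (hα : 1 < α) (hr : 0 < r)
    (y : ℝ) : 0 ≤ 1 - laplaceRoadIn muV Pv α s r y := by
  rw [← expNeg_roadExponent muV hs hα hr (0, y)]
  exact sub_nonneg.2 (expNeg_le_one _)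

lemma ofReal_one_sub_expNeg_le (x : ℝ≥0∞) : ENNReal.ofReal (1 - expNeg x) ≤ x := by
  by_cases hx : x = ∞
  · simp [hx]
  rw [expNeg_of_ne_top hx, ENNReal.ofReal_le_iff_le_toReal hx]
  linarith [Real.one_sub_le_exp_neg x.toReal]

/-- For finite `R` the integrand is bounded by `1` on a bounded set. For `R = ∞`, `1 - exp (-x) ≤ x`
reduces the claim to the planar integral of `vehicleLoss`. -/
lemma integrableOn_one_sub_laplaceRoadIn (muV : ℝ≥0) (hs : 0 ≤ s * Pv) (hα : 1 < α)
    (hαR : R = ∞ → 2 < α) (hr : 0 < r) :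
    IntegrableOn (fun y => 1 - laplaceRoadIn muV Pv α s r y) {y : ℝ | ENNReal.ofReal |y| ≤ R} := by
  have hm : Measurable fun y => 1 - laplaceRoadIn muV Pv α s r y :=
    (measurable_laplaceRoadIn muV hs hα hr).const_sub 1
  have hnn := one_sub_laplaceRoadIn_nonneg muV hs hα hr
  by_cases hR : R = ∞
  · refine Integrable.integrableOn ⟨hm.aestronglyMeasurable, ?_⟩
    rw [hasFiniteIntegral_iff_ofReal (ae_of_all _ hnn)]
    calc ∫⁻ y, ENNReal.ofReal (1 - laplaceRoadIn muV Pv α s r y)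
        ≤ ∫⁻ y, muV * ∫⁻ t, ENNReal.ofReal (vehicleLoss Pv α s r y t) := by
          refine lintegral_mono fun y => ?_
          rw [← expNeg_roadExponent muV hs hα hr (0, y)]
          refine (ofReal_one_sub_expNeg_le _).trans ?_
          rw [roadExponent_eq_lintegral]
      _ = muV * ∫⁻ y, ∫⁻ t, ENNReal.ofReal (vehicleLoss Pv α s r y t) := by
          rw [lintegral_const_mul' _ _ ENNReal.coe_ne_top]
      _ < ∞ := ENNReal.mul_lt_top ENNReal.coe_lt_top
          (lintegral_vehicleLoss_lt_top hs (hαR hR) hr)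
  · have hsub : {y : ℝ | ENNReal.ofReal |y| ≤ R} ⊆ Set.Icc (-R.toReal) R.toReal := fun y hy =>
      abs_le.1 ((ENNReal.ofReal_le_iff_le_toReal hR).1 hy)
    refine Measure.integrableOn_of_bounded (M := 1) ?_ hm.aestronglyMeasurable
      (ae_of_all _ fun y => ?_)
    · exact ((measure_mono hsub).trans_lt measure_Icc_lt_top).ne
    · rw [Real.norm_of_nonneg (hnn y)]
      have : 0 ≤ laplaceRoadIn muV Pv α s r y := (Real.exp_pos _).le
      linarith

lemma setIntegral_one_sub_laplaceRoadIn (muV : ℝ≥0) (hs : 0 ≤ s * Pv) (hα : 1 < α)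
    (hαR : R = ∞ → 2 < α) (hr : 0 < r) (hrR : ENNReal.ofReal r ≤ R) :
    ∫ y in {y : ℝ | ENNReal.ofReal |y| ≤ R}, (1 - laplaceRoadIn muV Pv α s r y)
      = 2 * ((∫ y in Set.Ioc 0 r, (1 - laplaceRoadIn muV Pv α s r y)) +
        ∫ y in {y : ℝ | r < y ∧ ENNReal.ofReal y ≤ R}, (1 - laplaceRoadOut muV Pv α s y)) := by
  have hint := integrableOn_one_sub_laplaceRoadIn muV hs hα hαR hr
  have hB := measurableSet_ofReal_abs_le R
  have hC : MeasurableSet {y : ℝ | r < y ∧ ENNReal.ofReal y ≤ R} :=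
    measurableSet_Ioi.inter (measurableSet_le ENNReal.measurable_ofReal measurable_const)
  have habs : ∀ y, {y : ℝ | ENNReal.ofReal |y| ≤ R}.indicator
      (fun y => 1 - laplaceRoadIn muV Pv α s r y) y = {y : ℝ | ENNReal.ofReal |y| ≤ R}.indicator
      (fun y => 1 - laplaceRoadIn muV Pv α s r y) |y| := fun y => by
    classical
    simp only [Set.indicator_apply, Set.mem_ofPred_eq, abs_abs, laplaceRoadIn_abs]
  have hunion : Set.Ioi 0 ∩ {y : ℝ | ENNReal.ofReal |y| ≤ R}
      = Set.Ioc 0 r ∪ {y : ℝ | r < y ∧ ENNReal.ofReal y ≤ R} := by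
    ext y
    simp only [Set.mem_inter_iff, Set.mem_Ioi, Set.mem_ofPred_eq, Set.mem_union, Set.mem_Ioc]
    constructor
    · rintro ⟨h0, h1⟩
      rw [abs_of_pos h0] at h1
      rcases le_or_gt y r with h | h
      · exact Or.inl ⟨h0, h⟩
      · exact Or.inr ⟨h, h1⟩
    · rintro (⟨h0, h1⟩ | ⟨h0, h1⟩)
      · rw [abs_of_pos h0]
        -- Here `r ≤ R` is used: otherwise `(0, r]` would include distances at which there are no
        -- roads.
        exact ⟨h0, (ENNReal.ofReal_le_ofReal h1).trans hrR⟩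
      · rw [abs_of_pos (hr.trans h0)]
        exact ⟨hr.trans h0, h1⟩
  have hsub := (hunion ▸ Set.inter_subset_right :
    Set.Ioc 0 r ∪ {y : ℝ | r < y ∧ ENNReal.ofReal y ≤ R} ⊆ {y : ℝ | ENNReal.ofReal |y| ≤ R})
  rw [← integral_indicator hB]
  rw [integral_congr_ae (ae_of_all _ habs), integral_comp_abs, setIntegral_indicator hB, hunion, setIntegral_union _ hC
    (hint.mono_set (Set.subset_union_left.trans hsub))
    (hint.mono_set (Set.subset_union_right.trans hsub))]
  · congr 2
    refine setIntegral_congr_fun hC fun y hy => ?_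
    rw [laplaceRoadIn_of_le hr (le_of_lt hy.1)]
  · rw [Set.disjoint_left]
    rintro y ⟨_, h1⟩ ⟨h2, _⟩
    exact h1.not_gt h2

lemma expNeg_lintegral_lineIntensity (lamR muV : ℝ≥0) (hs : 0 ≤ s * Pv) (hα : 1 < α)
    (hαR : R = ∞ → 2 < α) (hr : 0 < r) (hrR : ENNReal.ofReal r ≤ R) :
    expNeg (∫⁻ l, ENNReal.ofReal (1 - expNeg (roadExponent muV Pv α s r l))
        ∂(lineIntensity lamR R)) = laplaceOtherRoads lamR muV R Pv α s r := by
  have hnn := one_sub_laplaceRoadIn_nonneg muV hs hα hr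
  simp_rw [expNeg_roadExponent muV hs hα hr]
  rw [lintegral_lineIntensity lamR R
      (f := fun y => ENNReal.ofReal (1 - laplaceRoadIn muV Pv α s r y))
      ((measurable_laplaceRoadIn muV hs hα hr).const_sub 1).ennreal_ofReal,
    ← ofReal_integral_eq_lintegral_ofReal (integrableOn_one_sub_laplaceRoadIn muV hs hα hαR hr)
      (ae_of_all _ hnn), ← ENNReal.ofReal_mul Real.pi_pos.le, ← ENNReal.ofReal_coe_nnreal,
    ← ENNReal.ofReal_mul lamR.coe_nonneg, expNeg_ofReal,
    setIntegral_one_sub_laplaceRoadIn muV hs hα hαR hr hrR, laplaceOtherRoads, ← Real.exp_add]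
  · ring_nf
  · exact mul_nonneg lamR.coe_nonneg (mul_nonneg Real.pi_pos.le (integral_nonneg hnn))

end OtherRoads

/-! ### The closed form for the typical road -/

/-- Here `c = b + 1`, so the factor `(1 - u)^(c - b - 1)` is `1` and the Gamma quotient is `b = (α -
1) / α`. -/
lemma gaussHypergeometric_one_eq {α z : ℝ} (hα : 1 < α) :
    gaussHypergeometric 1 ((α - 1) / α) (2 - 1 / α) (-z)
      = (α - 1) / α * ∫ u in Set.Ioo (0 : ℝ) 1, u ^ (-1 / α) * (1 + z * u)⁻¹ := by
  have hα0 : α ≠ 0 := by linarith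
  have hb : 0 < (α - 1) / α := div_pos (by linarith) (by linarith)
  have hc : 2 - 1 / α = (α - 1) / α + 1 := by
    field_simp
    ring
  have hΓ := (Real.Gamma_pos_of_pos hb).ne'
  rw [gaussHypergeometric, hc, Real.Gamma_add_one hb.ne', add_sub_cancel_left, Real.Gamma_one,
    mul_one, mul_div_assoc, div_self hΓ, mul_one, intervalIntegral.integral_of_le zero_le_one,
    integral_Ioc_eq_integral_Ioo]
  congr 1
  refine setIntegral_congr_fun measurableSet_Ioo fun u _ => ?_
  have he : (α - 1) / α - 1 = -1 / α := by
    field_simp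
    ring
  rw [sub_self, Real.rpow_zero, mul_one, he, Real.rpow_neg_one]
  ring_nf

/-- Substitute `t = u^(-1/α)`: the integrand becomes `z u / (1 + z u)`, and its factor `u` combines
with the Jacobian `u^(-1/α - 1) / α`. -/
lemma integral_Ioi_one_vehicle {α z : ℝ} (hα : 1 < α) (hz : 0 < z) :
    ∫ t in Set.Ioi (1 : ℝ), (1 - 1 / (1 + z * t ^ (-α)))
      = z / α * ∫ u in Set.Ioo (0 : ℝ) 1, u ^ (-1 / α) * (1 + z * u)⁻¹ := by
  classical
  have hα0 : 0 < α := by linarith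
  have hp : -1 / α < 0 := div_neg_of_neg_of_pos (by norm_num) hα0
  have h := integral_comp_rpow_Ioi
    ((Set.Ioi (1 : ℝ)).indicator fun t => 1 - 1 / (1 + z * t ^ (-α))) hp.ne
  rw [setIntegral_indicator measurableSet_Ioi, Set.inter_eq_right.2
    (Set.Ioi_subset_Ioi zero_le_one)] at h
  rw [← h, ← integral_const_mul, ← Set.Ioi_inter_Iio, ← setIntegral_indicator measurableSet_Iio]
  refine setIntegral_congr_fun measurableSet_Ioi fun u hu => ?_
  have hu0 : 0 < u := hu
  simp only [Set.indicator_apply, Set.mem_Ioi, Set.mem_Iio, smul_eq_mul]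
  have hiff : 1 < u ^ (-1 / α) ↔ u < 1 := by
    rw [Real.one_lt_rpow_iff_of_pos hu0]
    constructor
    · rintro (⟨_, h⟩ | ⟨h, _⟩)
      · exact absurd h hp.not_gt
      · exact h
    · exact fun h => Or.inr ⟨h, hp⟩
  simp only [hiff]
  split_ifs with h1
  swap
  · simp
  have hpow : (u ^ (-1 / α)) ^ (-α) = u := by
    rw [← Real.rpow_mul hu0.le, div_mul_eq_mul_div, neg_one_mul, neg_neg, div_self hα0.ne',
      Real.rpow_one]
  have habs : |-1 / α| = 1 / α := by
    rw [abs_of_neg hp]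
    ring
  have hzu : 1 + z * u ≠ 0 := by positivity
  rw [hpow, habs, Real.rpow_sub_one hu0.ne']
  field_simp
  ring

/-- At this `s` the vehicle term on a line through the origin is `z (t / r)^(-α)`, so rescaling by
`r` removes `r` from the integrand. -/
lemma laplaceRoadIn_zero (muV : ℝ≥0) {Pv α z r : ℝ} (hPv : 0 < Pv) (hα : 1 < α) (hz : 0 < z)
    (hr : 0 < r) :
    laplaceRoadIn muV Pv α (z / (Pv * r ^ (-α))) r 0 = laplaceTypicalRoad muV α z r := by
  have hint : ∫ t in Set.Ioi √(r ^ 2 - 0 ^ 2),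
      (1 - 1 / (1 + z / (Pv * r ^ (-α)) * Pv * (0 ^ 2 + t ^ 2) ^ (-α / 2)))
      = r * ∫ t in Set.Ioi (1 : ℝ), (1 - 1 / (1 + z * t ^ (-α))) := by
    have h := integral_comp_mul_left_Ioi (fun t => 1 - 1 / (1 + z * t ^ (-α))) r (inv_pos.2 hr)
    rw [inv_inv, inv_mul_cancel₀ hr.ne', smul_eq_mul] at h
    rw [← h, zero_pow two_ne_zero, sub_zero, Real.sqrt_sq hr.le]
    refine setIntegral_congr_fun measurableSet_Ioi fun t ht => ?_
    have ht0 : 0 < t := hr.trans ht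
    have hrα : r ^ (-α) ≠ 0 := (Real.rpow_pos_of_pos hr _).ne'
    rw [zero_add, ← sqrt_rpow_neg (sq_nonneg t), Real.sqrt_sq ht0.le,
      Real.mul_rpow (inv_pos.2 hr).le ht0.le, Real.inv_rpow hr.le]
    field_simp
  rw [laplaceRoadIn, hint, integral_Ioi_one_vehicle hα hz, laplaceTypicalRoad,
    gaussHypergeometric_one_eq hα]
  congr 1
  have : α - 1 ≠ 0 := by linarith
  have : α ≠ 0 := by linarith
  field_simp

end V2X

/-! ### Closed forms of the two Laplace transforms, and the theorem -/

namespace V2X.Network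

variable {Ω : Type*} [MeasurableSpace Ω] {P : Measure Ω} [IsProbabilityMeasure P]
  {lamR muV lamB : ℝ≥0} {R : ℝ≥0∞} (N : Network P lamR muV lamB R) {Pv α z r : ℝ}

theorem laplaceTransform_otherRoadsInterference {s : ℝ} (hPv : 0 ≤ Pv) (hs : 0 ≤ s) (hα : 1 < α)
    (hαR : R = ∞ → 2 < α) (hr : 0 < r) (hrR : ENNReal.ofReal r ≤ R) :
    laplaceTransform P (N.otherRoadsInterference Pv α r) s
      = laplaceOtherRoads lamR muV R Pv α s r := by
  rw [laplaceTransform, N.integral_expNeg_otherRoadsInterference hPv hs,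
    expNeg_lintegral_lineIntensity lamR muV (mul_nonneg hs hPv) hα hαR hr hrR]

theorem laplaceTransform_typicalRoadInterference (hPv : 0 < Pv) (hα : 1 < α) (hz : 0 < z)
    (hr : 0 < r) :
    laplaceTransform P (N.typicalRoadInterference Pv α r) (z / (Pv * r ^ (-α)))
      = laplaceTypicalRoad muV α z r := by
  have hs : 0 ≤ z / (Pv * r ^ (-α)) := by positivity
  rw [← laplaceRoadIn_zero muV hPv hα hz hr,
    ← expNeg_roadExponent muV (mul_nonneg hs hPv.le) hα hr (N.angle, 0)]
  exact N.integral_expNeg_lineInterference hPv.le hs none (N.angle, 0)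

end V2X.Network

theorem mainTheorem2 {Ω : Type*} [MeasurableSpace Ω] (P : Measure Ω) [IsProbabilityMeasure P]
    (lamR muV lamB : ℝ≥0) (R : ℝ≥0∞) (N : V2X.Network P lamR muV lamB R)
    (Pv α σ2 z : ℝ) (hlamB : 0 < lamB) (hPv : 0 < Pv) (hσ2 : 0 ≤ σ2) (hz : 0 < z)
    (hα : 1 < α) (hαR : R = ∞ → 2 < α) :
    -- at every fixed link distance `r`, with exclusion radius `r`
    (∀ r : ℝ, 0 < r → ENNReal.ofReal r ≤ R →
      P.real {ω | ENNReal.ofReal z < N.sinr Pv α σ2 r ω} =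
        Real.exp (-(z * σ2 / (Pv * r ^ (-α)))) *
          V2X.laplaceTransform P (N.otherRoadsInterference Pv α r) (z / (Pv * r ^ (-α))) *
          V2X.laplaceTransform P (N.typicalRoadInterference Pv α r) (z / (Pv * r ^ (-α))) ∧
      V2X.laplaceTransform P (N.otherRoadsInterference Pv α r) (z / (Pv * r ^ (-α))) =
        V2X.laplaceOtherRoads lamR muV R Pv α (z / (Pv * r ^ (-α))) r ∧
      V2X.laplaceTransform P (N.typicalRoadInterference Pv α r) (z / (Pv * r ^ (-α))) =
        V2X.laplaceTypicalRoad muV α z r) ∧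
    -- conditionally on the distance to the nearest base station
    (∀ᵐ ω ∂P, ENNReal.ofReal (N.nearestStationDist ω) ≤ R →
      (P⟦{ω' | ENNReal.ofReal z < N.sinr Pv α σ2 (N.nearestStationDist ω') ω'} |
          MeasurableSpace.comap N.nearestStationDist inferInstance⟧) ω =
        V2X.successFormula lamR muV R Pv α σ2 z (N.nearestStationDist ω)) := by
  have hfixed : ∀ r : ℝ, 0 < r → ENNReal.ofReal r ≤ R →
      P.real {ω | ENNReal.ofReal z < N.sinr Pv α σ2 r ω} =
        Real.exp (-(z * σ2 / (Pv * r ^ (-α)))) *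
          V2X.laplaceTransform P (N.otherRoadsInterference Pv α r) (z / (Pv * r ^ (-α))) *
          V2X.laplaceTransform P (N.typicalRoadInterference Pv α r) (z / (Pv * r ^ (-α))) ∧
      V2X.laplaceTransform P (N.otherRoadsInterference Pv α r) (z / (Pv * r ^ (-α))) =
        V2X.laplaceOtherRoads lamR muV R Pv α (z / (Pv * r ^ (-α))) r ∧
      V2X.laplaceTransform P (N.typicalRoadInterference Pv α r) (z / (Pv * r ^ (-α))) =
        V2X.laplaceTypicalRoad muV α z r := fun r hr hrR =>
    ⟨N.measureReal_lt_sinr hPv hσ2 hr hz,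
      N.laplaceTransform_otherRoadsInterference hPv.le (by positivity) hα hαR hr hrR,
      N.laplaceTransform_typicalRoadInterference hPv hα hz hr⟩
  refine ⟨hfixed, ?_⟩
  -- Almost sure positivity of `R_b` permits evaluating the fixed-distance formula at `r = R_b`.
  filter_upwards [N.condExp_sinr_nearestStationDist Pv α σ2 z, N.ae_nearestStationDist_pos hlamB]
    with ω hω hpos hR
  obtain ⟨h1, h2, h3⟩ := hfixed _ hpos hR
  rw [hω, h1, h2, h3, V2X.successFormula]
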